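/- Let $\mathcal O$ be a complete discrete valuation ring whose residue field $k$ has characteristic $p>0$ ($k$ need not be algebraically closed). Let $G$ be a finite group, $H$ a normal subgroup, $\bar G=G/H$, and let $b$ be a $G$-invariant block of $\mathcal OH$, that is, a primitive idempotent of $Z(\mathcal OH)$ fixed by $G$-conjugation. Put $A=\mathcal OGb$, a $\bar G$-graded algebra with identity component $B=\mathcal OHb$. Let $P$ be a $p$-subgroup of $G$, let $\gamma$ be a local point of $B^P$ (a $(B^P)^\times$-conjugacy class of primitive idempotents of $B^P$ not contained in the kernel $\sum_{Q<P}\mathrm{Tr}_Q^P(B^Q)+J(\mathcal O)B^P$ of the Brauer homomorphism), and let $i\in\gamma$. Let $N_G(P_\gamma)=\{g\in N_G(P)\mid {}^g\gamma=\gamma\}$ and $E=N_G(P_\gamma)/C_H(P)$. Let $B^P*E=B^P\otimes_{\mathcal OC_H(P)}\mathcal ON_G(P_\gamma)$ with multiplication $(a\otimes g)(c\otimes h)=a\,{}^gc\otimes gh$, graded by $E$, and \[\mathcal E=\operatorname{End}_{B^P*E}\bigl(M\bigr)^{\mathrm{op}},\qquad M=(B^P*E)\otimes_{B^P}B^Pi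 .\] For $e\in E$, let $\mathcal E_e$ be the set of those $f\in\mathcal E$ with $f(M_x)\subseteq M_{xe}$ for all $x\in E$, where $M_x=(B^P*E)_x\otimes_{B^P} B^Pi$. Let $F$ be the group of all pairs $(\varphi,y)\in\operatorname{Aut}(P)\times\bar G$ such that $\overline{\varphi(u)}=y\bar uy^{-1}$ for all $u\in P$ and $Ai\simeq (Ai)(y^{-1})_\varphi$ as $\bar G$-graded $(A,\mathcal OP)$-bimodules; here $(Ai)(y^{-1})_\varphi$ is $Ai$ as a left $A$-module, its component of degree $x$ is $(Ai)_{xy^{-1}}$, and $u\in P$ acts on the right as $\varphi(u)$. Let $C=\mathcal OP*F$ be the skew group algebra of $F$ over $\mathcal OP$, where $F$ acts via $(\varphi,y)\mapsto\varphi$. It is $F$-graded, and also $\bar G$-graded, with $u\,(\varphi,y)$ of degree $\bar uy$. Let $\mathcal F$ be the opposite of the algebra of those endomorphisms of the $(A,C)$-bimodule $N=Ai\otimes_{\mathcal OP}C$ that preserve its $\bar G$-grading (with $m\otimes c$ of degree $\deg m\deg c$). For $t\in F$, let $\mathcal F_t$ be the set of those $f\in\mathcal F$ with $f(N_x)\subseteq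 N_{t^{-1}x}$ for all $x\in F$, where $N_x=Ai\otimes_{\mathcal OP} C_x$. Then $(\mathcal E_e)_{e\in E}$ and $(\mathcal F_t)_{t\in F}$ are gradings of the $\mathcal O$-algebras $\mathcal E$ and $\mathcal F$ by $E$ and $F$; the map $gC_H(P)\mapsto(u\mapsto gug^{-1},\,gH)$ is a well-defined group isomorphism $\theta\colon E\to F$; and there is an isomorphism of $\mathcal O$-algebras $\Psi\colon\mathcal E\to\mathcal F$ with $\Psi(\mathcal E_e)=\mathcal F_{\theta(e)}$ for all $e\in E$. -/

import Mathlib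

open scoped TensorProduct

noncomputable section

/-! ### Generalities on idempotents, graded algebras and tensor products -/

/-- A primitive idempotent of a ring: a nonzero idempotent `e` such that the only idempotents `f`
with `e f = f = f e` are `0` and `e`. -/
structure IsPrimitiveIdem {R : Type*} [Ring R] (e : R) : Prop where
  ne_zero : e ≠ 0
  idem : IsIdempotentElem e
  eq_or : ∀ f : R, IsIdempotentElem f → e * f = f → f * e = f → f = 0 ∨ f = e

/-- A point of a ring: a conjugacy class (under the units) of primitive idempotents. -/
def IsPoint {R : Type*} [Ring R] (γ : Set R) : Prop :=
  ∃ e : R, IsPrimitiveIdem e ∧ γ = conjugatesOf e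

/-- The family `𝒜` of submodules is a grading of the `O`-algebra `R` by the group `Γ`. -/
structure IsAlgGrading (O R : Type*) {Γ : Type*} [CommRing O] [Ring R] [Algebra O R] [Group Γ]
    (𝒜 : Γ → Submodule O R) : Prop where
  one_mem : (1 : R) ∈ 𝒜 1
  mul_mem : ∀ {x y : Γ} {a c : R}, a ∈ 𝒜 x → c ∈ 𝒜 y → a * c ∈ 𝒜 (x * y)
  indep : iSupIndep 𝒜
  iSup_eq_top : ⨆ x, 𝒜 x = ⊤

section BalTensor

variable {O S M N : Type*} [CommRing O] [AddCommGroup M] [Module O M] [AddCommGroup N] [Module O N]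

/-- The relations `m s ⊗ n = m ⊗ s n` of a tensor product over a noncommutative ring `S`. -/
def balRel (ρ : S → M →ₗ[O] M) (l : S → N →ₗ[O] N) : Submodule O (M ⊗[O] N) :=
  Submodule.span O {t | ∃ (s : S) (m : M) (n : N), t = ρ s m ⊗ₜ[O] n - m ⊗ₜ[O] l s n}

/-- The tensor product `M ⊗_S N` of a right module `M` (with action `ρ s m = m s`) and a left module
`N` (with action `l s n = s n`) over a not necessarily commutative `O`-algebra `S`. -/
abbrev BalTensor (ρ : S → M →ₗ[O] M) (l : S → N →ₗ[O] N) : Type _ :=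
  (M ⊗[O] N) ⧸ balRel ρ l

namespace BalTensor

variable (ρ : S → M →ₗ[O] M) (l : S → N →ₗ[O] N)

/-- The class of `m ⊗ n` in `M ⊗_S N`. -/
def tmul (m : M) (n : N) : BalTensor ρ l := (balRel ρ l).mkQ (m ⊗ₜ[O] n)

/-- The endomorphism `m ⊗ n ↦ f m ⊗ h n` of `M ⊗_S N`, for `S`-linear `f` and `h`. -/
def map (f : M →ₗ[O] M) (h : N →ₗ[O] N) (hf : ∀ s m, f (ρ s m) = ρ s (f m))
    (hh : ∀ s n, h (l s n) = l s (h n)) : Module.End O (BalTensor ρ l) :=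
  (balRel ρ l).mapQ (balRel ρ l) (TensorProduct.map f h) (by
    rw [balRel, Submodule.span_le]
    rintro _ ⟨s, m, n, rfl⟩
    refine Submodule.subset_span ⟨s, f m, h n, ?_⟩
    simp [hf, hh])

end BalTensor

end BalTensor

/-! ### Crossed products -/

section Crossed

variable (O : Type*) {N S : Type*} [CommRing O] [Group N] [Ring S] [Algebra O S]
  [MulSemiringAction N S] [SMulCommClass N O S]

/-- The defining relations `ι z ⊗ 1 = 1 ⊗ z` (`z ∈ K`) of the crossed product. -/
def crossedRel (K : Subgroup N) (ι : K →* S) :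
    SkewMonoidAlgebra S N → SkewMonoidAlgebra S N → Prop :=
  fun x y => ∃ z : K, x = SkewMonoidAlgebra.single 1 (ι z) ∧
    y = SkewMonoidAlgebra.single (z : N) 1

/-- For a `K`-interior `N`-algebra `S`, with `K` normal in `N`, the crossed product
`S * (N / K) = S ⊗_{OK} ON`, with multiplication `(s ⊗ g) (t ⊗ h) = s ᵍt ⊗ g h`.  It is the quotient
of the skew group algebra of `N` over `S` (in which `(s g) (t h) = s ᵍt g h`) that identifies each
`z ∈ K` with its image in `S`. -/
abbrev CrossedProduct (K : Subgroup N) (ι : K →* S) : Type _ := RingQuot (crossedRel K ι)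

namespace CrossedProduct

variable (K : Subgroup N) (ι : K →* S)

/-- The element `s ⊗ g` of the crossed product. -/
def elt (s : S) (g : N) : CrossedProduct K ι :=
  RingQuot.mkAlgHom O (crossedRel K ι) (SkewMonoidAlgebra.single g s)

/-- The homogeneous component of degree `e ∈ N / K` of the crossed product. -/
def comp (e : N ⧸ K) : Submodule O (CrossedProduct K ι) :=
  Submodule.span O {x | ∃ (s : S) (g : N), (g : N ⧸ K) = e ∧ x = elt O K ι s g}

end CrossedProduct

end Crossed

/-! ### Graded interior algebras, pointed groups and fusions -/

/-- A `G/H`-graded `G`-interior `O`-algebra structure on `A`. -/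
structure GradedInterior (O : Type*) [CommRing O] {G : Type*} [Group G] (H : Subgroup G) [H.Normal]
    (A : Type*) [Ring A] [Algebra O A] where
  /-- the homogeneous components -/
  comp : G ⧸ H → Submodule O A
  grading : IsAlgGrading O A comp
  /-- the structural map -/
  σ : G →* A
  σ_mem : ∀ g : G, σ g ∈ comp (g : G ⧸ H)

namespace GradedInterior

variable {O : Type*} [CommRing O] {G : Type*} [Group G] {H : Subgroup G} [H.Normal]
  {A : Type*} [Ring A] [Algebra O A] (D : GradedInterior O H A) (P : Subgroup G)

/-- The action `a ↦ ᵍa` of `G` on `A` by conjugation. -/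
def conj (g : G) (a : A) : A := D.σ g * a * D.σ g⁻¹

theorem σ_mul_inv (g : G) : D.σ g * D.σ g⁻¹ = 1 := by rw [← map_mul]; simp

theorem σ_inv_mul (g : G) : D.σ g⁻¹ * D.σ g = 1 := by rw [← map_mul]; simp

theorem conj_one (a : A) : D.conj 1 a = a := by simp [conj]

theorem conj_conj (g h : G) (a : A) : D.conj g (D.conj h a) = D.conj (g * h) a := by
  simp [conj, mul_assoc]

theorem conj_mul (g : G) (a c : A) : D.conj g (a * c) = D.conj g a * D.conj g c := by
  have h := D.σ_inv_mul g
  calc D.σ g * (a * c) * D.σ g⁻¹ = D.σ g * a * 1 * c * D.σ g⁻¹ := by simp [mul_assoc]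
    _ = _ := by rw [← h]; simp only [conj, mul_assoc]

/-- The algebra `B^P` of `P`-fixed elements of the identity component `B` of `A`. -/
def fix : Subalgebra O A where
  carrier := {a | a ∈ D.comp 1 ∧ ∀ u ∈ P, D.σ u * a = a * D.σ u}
  mul_mem' := by
    rintro a c ⟨ha, ha'⟩ ⟨hc, hc'⟩
    refine ⟨by simpa using D.grading.mul_mem ha hc, fun u hu => ?_⟩
    rw [← mul_assoc, ha' u hu, mul_assoc, hc' u hu, mul_assoc]
  add_mem' := by
    rintro a c ⟨ha, ha'⟩ ⟨hc, hc'⟩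
    exact ⟨add_mem ha hc, fun u hu => by rw [mul_add, add_mul, ha' u hu, hc' u hu]⟩
  algebraMap_mem' r := by
    refine ⟨?_, fun u _ => (Algebra.commutes r _).symm⟩
    rw [Algebra.algebraMap_eq_smul_one]
    exact Submodule.smul_mem _ _ D.grading.one_mem

theorem conj_mem_fix {g : G} (hg : g ∈ Subgroup.normalizer (P : Set G)) {a : A}
    (ha : a ∈ D.fix P) : D.conj g a ∈ D.fix P := by
  obtain ⟨h1, h2⟩ := ha
  refine ⟨?_, fun u hu => ?_⟩
  · have := D.grading.mul_mem (D.grading.mul_mem (D.σ_mem g) h1) (D.σ_mem g⁻¹)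
    simpa [conj] using this
  · have hu' : g⁻¹ * u * g ∈ P := by
      have := (Subgroup.mem_normalizer_iff.1 ((Subgroup.normalizer (P : Set G)).inv_mem hg) u).1 hu
      simpa using this
    have h3 := h2 _ hu'
    calc D.σ u * D.conj g a = D.σ g * (D.σ (g⁻¹ * u * g) * a) * D.σ g⁻¹ := by
          simp only [conj, ← mul_assoc, ← map_mul]; simp
      _ = D.conj g a * D.σ u := by
          rw [h3]; simp only [conj, mul_assoc, ← map_mul]; simp

/-- The relative trace `Tr_Q^P (a) = ∑_{x ∈ P/Q} ˣa`, for a `Q`-fixed element `a`. -/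
def relTrace (Q : Subgroup G) (a : A) : A :=
  ∑ᶠ x : P ⧸ Q.subgroupOf P, D.conj (x.out : P) a

/-- The kernel `∑_{Q < P} Tr_Q^P (B^Q) + J(O) B^P` of the Brauer homomorphism `Br_P` on `B^P`. -/
def brauerKer [IsLocalRing O] : Submodule O A :=
  Submodule.span O {t | ∃ Q : Subgroup G, Q < P ∧ ∃ a ∈ D.fix Q, t = D.relTrace P Q a} ⊔
    IsLocalRing.maximalIdeal O • Subalgebra.toSubmodule (D.fix P)

/-- `γ` is a local point of `B^P`, that is, `P_γ` is a local pointed group on `B`: it is a point and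
`Br_P (γ) ≠ 0`. -/
def IsLocalPoint [IsLocalRing O] (γ : Set (D.fix P)) : Prop :=
  IsPoint γ ∧ ∃ j ∈ γ, (j : A) ∉ D.brauerKer P

section GFusion

variable {P} (γ : Set (D.fix P))

/-- The stabilizer `N_G(P_γ)` of the pointed group `P_γ` in `G`. -/
def normPt : Subgroup G where
  carrier := {g | g ∈ Subgroup.normalizer (P : Set G) ∧
    D.conj g '' (Subtype.val '' γ) = Subtype.val '' γ}
  mul_mem' := by
    rintro g h ⟨hg, hg'⟩ ⟨hh, hh'⟩
    refine ⟨mul_mem hg hh, ?_⟩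
    have : D.conj (g * h) = D.conj g ∘ D.conj h := funext fun a => (D.conj_conj g h a).symm
    rw [this, Set.image_comp, hh', hg']
  one_mem' := by
    refine ⟨one_mem _, ?_⟩
    have : D.conj 1 = id := funext fun a => D.conj_one a
    rw [this, Set.image_id]
  inv_mem' := by
    rintro g ⟨hg, hg'⟩
    refine ⟨inv_mem hg, ?_⟩
    have : D.conj g⁻¹ ∘ D.conj g = id := funext fun a => by
      rw [Function.comp_apply, conj_conj, inv_mul_cancel, conj_one, id]
    conv_lhs => rw [← hg', ← Set.image_comp, this, Set.image_id]

/-- `C_H(P)`, as a subgroup of `N_G(P_γ)`. -/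
def centH : Subgroup (D.normPt γ) :=
  (H ⊓ Subgroup.centralizer (P : Set G)).subgroupOf (D.normPt γ)

instance : (D.centH γ).Normal where
  conj_mem := by
    rintro ⟨z, hz⟩ hz' ⟨g, hg⟩
    rw [centH, Subgroup.mem_subgroupOf] at hz' ⊢
    obtain ⟨h1, h2⟩ := hz'
    refine ⟨Subgroup.Normal.conj_mem inferInstance _ h1 _, ?_⟩
    replace h2 := Subgroup.mem_centralizer_iff.1 h2
    refine Subgroup.mem_centralizer_iff.2 fun u hu => ?_
    have hu' : g⁻¹ * u * g ∈ P := by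
      have := (Subgroup.mem_normalizer_iff.1
        ((Subgroup.normalizer (P : Set G)).inv_mem hg.1) u).1 hu
      simpa using this
    have h3 := h2 _ hu'
    have h4 : g * (g⁻¹ * u * g * z) * g⁻¹ = g * (z * (g⁻¹ * u * g)) * g⁻¹ := by
      exact congrArg (fun t => g * t * g⁻¹) h3
    simpa [mul_assoc] using h4

/-- The group `E = N_G(P_γ) / C_H(P)` of `(G, G/H)`-fusions of `P_γ`. -/
abbrev gFusion : Type _ := D.normPt γ ⧸ D.centH γ

/-- `N_G(P_γ)` acts on `B^P` by conjugation. -/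
instance : MulSemiringAction (D.normPt γ) (D.fix P) where
  smul g a := ⟨D.conj g a, D.conj_mem_fix P g.2.1 a.2⟩
  one_smul a := Subtype.ext (D.conj_one _)
  mul_smul g h a := Subtype.ext (D.conj_conj _ _ _).symm
  smul_zero g := Subtype.ext (show D.conj g 0 = 0 by simp [conj])
  smul_add g a c := Subtype.ext (show D.conj g (a + c) = D.conj g a + D.conj g c by
    simp [conj, mul_add, add_mul])
  smul_one g := Subtype.ext (show D.conj g 1 = 1 by simp [conj, σ_mul_inv])
  smul_mul g a c := Subtype.ext (D.conj_mul _ _ _)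

theorem coe_smul_fix (g : D.normPt γ) (a : D.fix P) : ((g • a : D.fix P) : A) = D.conj g a := rfl

instance : SMulCommClass (D.normPt γ) O (D.fix P) where
  smul_comm g r a := Subtype.ext (by simp [coe_smul_fix, conj])

/-- The interior structure `C_H(P) → B^P`. -/
def intHom : D.centH γ →* D.fix P where
  toFun z := ⟨D.σ ((z : D.normPt γ) : G), by
    obtain ⟨⟨z, hz⟩, hz'⟩ := z
    rw [centH, Subgroup.mem_subgroupOf] at hz'
    obtain ⟨h1, h2⟩ := hz'
    refine ⟨?_, fun u hu => ?_⟩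
    · have h := D.σ_mem z
      rwa [(QuotientGroup.eq_one_iff z).2 h1] at h
    · rw [← map_mul, ← map_mul, Subgroup.mem_centralizer_iff.1 h2 u hu]⟩
  map_one' := Subtype.ext (by simp)
  map_mul' z w := Subtype.ext (by simp)

/-- The `E`-graded crossed product `B^P * E`. -/
abbrev BPE : Type _ := CrossedProduct (D.centH γ) (D.intHom γ)

variable (i : D.fix P)

/-- The left `B^P`-module `B^P i`. -/
abbrev BPi : Submodule (D.fix P) (D.fix P) := Submodule.span (D.fix P) {i}

/-- The right action of `B^P` on `B^P * E`. -/
def rightBP (s : D.fix P) : D.BPE γ →ₗ[O] D.BPE γ :=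
  LinearMap.mulRight O (CrossedProduct.elt O (D.centH γ) (D.intHom γ) s 1)

/-- The left action of `B^P` on `B^P i`. -/
def leftBP (s : D.fix P) : D.BPi i →ₗ[O] D.BPi i := Module.toModuleEnd O (D.BPi i) s

/-- The induced module `(B^P * E) ⊗_{B^P} B^P i`. -/
abbrev indE : Type _ := BalTensor (D.rightBP γ) (D.leftBP i)

/-- The left action of `B^P * E` on the induced module. -/
def actE (r : D.BPE γ) : Module.End O (D.indE γ i) :=
  BalTensor.map _ _ (LinearMap.mulLeft O r) LinearMap.id
    (fun s m => by simp [rightBP, mul_assoc]) (fun _ _ => rfl)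

/-- The `E`-grading of the induced module. -/
def indEComp (x : D.gFusion γ) : Submodule O (D.indE γ i) :=
  Submodule.span O {t | ∃ r ∈ CrossedProduct.comp O (D.centH γ) (D.intHom γ) x, ∃ m : D.BPi i,
    t = BalTensor.tmul _ _ r m}

/-- The algebra of `B^P * E`-linear endomorphisms of the induced module. -/
def endE : Subalgebra O (Module.End O (D.indE γ i)) :=
  Subalgebra.centralizer O (Set.range (D.actE γ i))

/-- The algebra `𝓔 = End_{B^P * E} ((B^P * E) ⊗_{B^P} B^P i)^op`. -/
abbrev calE : Type _ := (D.endE γ i)ᵐᵒᵖ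

/-- The component of degree `e` of `𝓔`: the endomorphisms mapping the component of degree `x` of the
induced module to the one of degree `x e`, for all `x ∈ E`. -/
def calEComp (e : D.gFusion γ) : Submodule O (D.calE γ i) where
  carrier := {f | ∀ x, ∀ m ∈ D.indEComp γ i x, f.unop.1 m ∈ D.indEComp γ i (x * e)}
  add_mem' hf hh x m hm := add_mem (hf x m hm) (hh x m hm)
  zero_mem' _ _ _ := zero_mem _
  smul_mem' r _ hf x m hm := Submodule.smul_mem _ r (hf x m hm)

end GFusion

section AFusion

variable {P} (i : D.fix P)

/-- The left `A`-module `A i`. -/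
abbrev Ai : Submodule A A := Submodule.span A {(i : A)}

/-- The structural map `OP → A`. -/
def σP (P : Subgroup G) : MonoidAlgebra O P →ₐ[O] A :=
  MonoidAlgebra.lift O A P (D.σ.comp P.subtype)

theorem σP_comm (s : MonoidAlgebra O P) : D.σP P s * i = i * D.σP P s := by
  induction s using MonoidAlgebra.induction_on with
  | of u => simpa [σP] using i.2.2 u u.2
  | add x y hx hy => rw [map_add, add_mul, mul_add, hx, hy]
  | smul r x hx => rw [map_smul, smul_mul_assoc, hx, mul_smul_comm]

/-- The right action of `OP` on `A i`. -/
def rightP (s : MonoidAlgebra O P) : D.Ai i →ₗ[O] D.Ai i where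
  toFun m := ⟨(m : A) * D.σP P s, by
    obtain ⟨m, hm⟩ := m
    obtain ⟨a, rfl⟩ := Submodule.mem_span_singleton.1 hm
    refine Submodule.mem_span_singleton.2 ⟨a * D.σP P s, ?_⟩
    simp [mul_assoc, σP_comm]⟩
  map_add' m n := Subtype.ext (by simp [add_mul])
  map_smul' r m := Subtype.ext (by simp)

/-- The `G/H`-grading of `A i`. -/
def AiComp (x : G ⧸ H) : Submodule O (D.Ai i) :=
  (D.comp x).comap ((D.Ai i).subtype.restrictScalars O)

/-- `A i ≃ (A i)(y⁻¹)_φ` as `G/H`-graded `(A, OP)`-bimodules.  The component of degree `x` of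
`(A i)(y⁻¹)_φ` is the component of degree `x y⁻¹` of `A i`, and `u ∈ P` acts on the right as
`φ(u)`. -/
def FusionIso (φ : MulAut P) (y : G ⧸ H) : Prop :=
  ∃ f : D.Ai i ≃ₗ[A] D.Ai i,
    (∀ x m, m ∈ D.AiComp i x ↔ f m ∈ D.AiComp i (x * y⁻¹)) ∧
    ∀ (u : P) (m : D.Ai i), f (D.rightP i (MonoidAlgebra.of O P u) m) =
      D.rightP i (MonoidAlgebra.of O P (φ u)) (f m)

/-- The group `F` of `(A, G/H)`-fusions of `P_γ`, `γ` the point of `i`: the pairs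
`(φ, y) ∈ Aut(P) × G/H` such that the class of `φ(u)` is the `y`-conjugate of the class of `u`, for
all `u ∈ P`, and `A i ≃ (A i)(y⁻¹)_φ` as `G/H`-graded `(A, OP)`-bimodules. -/
def aFusion : Subgroup (MulAut P × (G ⧸ H)) where
  carrier := {t | (∀ u : P, ((t.1 u : G) : G ⧸ H) = t.2 * ((u : G) : G ⧸ H) * t.2⁻¹) ∧
    D.FusionIso i t.1 t.2}
  mul_mem' := by
    rintro ⟨φ, y⟩ ⟨ψ, z⟩ ⟨h1, f, hf, hf'⟩ ⟨h2, k, hk, hk'⟩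
    refine ⟨fun u => ?_, k.trans f, fun x m => ?_, fun u m => ?_⟩
    · simp only [Prod.mk_mul_mk, MulAut.mul_apply] at h1 h2 ⊢
      rw [h1, h2]; group
    · rw [hk, hf]; simp [mul_assoc]
    · exact (congrArg f (hk' u m)).trans (hf' _ _)
  one_mem' := ⟨fun u => by simp, LinearEquiv.refl _ _, fun x m => by simp, fun u m => by simp⟩
  inv_mem' := by
    rintro ⟨φ, y⟩ ⟨h1, f, hf, hf'⟩
    refine ⟨fun u => ?_, f.symm, fun x m => ?_, fun u m => ?_⟩
    · have := h1 (φ⁻¹ u)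
      simp only [MulAut.apply_inv_self] at this
      simp [this, mul_assoc]
    · have := hf (x * y) (f.symm m)
      simpa using this.symm
    · apply f.injective
      rw [hf']
      simp

/-- `F` acts on `OP` through its action on `P`. -/
instance : MulSemiringAction (D.aFusion i) (MonoidAlgebra O P) where
  smul t s := MonoidAlgebra.domCongr O O t.1.1 s
  one_smul s := by
    change MonoidAlgebra.domCongr O O (MulEquiv.refl P) s = s
    simp
  mul_smul t w s := by
    change MonoidAlgebra.domCongr O O (t.1.1 * w.1.1) s =
      MonoidAlgebra.domCongr O O t.1.1 (MonoidAlgebra.domCongr O O w.1.1 s)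
    ext
    simp
    rfl
  smul_zero t := map_zero (MonoidAlgebra.domCongr O O t.1.1)
  smul_add t := map_add (MonoidAlgebra.domCongr O O t.1.1)
  smul_one t := map_one (MonoidAlgebra.domCongr O O t.1.1)
  smul_mul t := map_mul (MonoidAlgebra.domCongr O O t.1.1)

instance : SMulCommClass (D.aFusion i) O (MonoidAlgebra O P) where
  smul_comm t r s := map_smul (MonoidAlgebra.domCongr O O t.1.1) r s

/-- The `F`-graded crossed product `C = OP * F`, with multiplication
`(s t) (s' t') = s ᵗs' t t'` for `s, s' ∈ OP` and `t, t' ∈ F`. -/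
abbrev algC : Type _ := SkewMonoidAlgebra (MonoidAlgebra O P) (D.aFusion i)

/-- The left action of `OP` on `C`. -/
def leftP (s : MonoidAlgebra O P) : D.algC i →ₗ[O] D.algC i :=
  LinearMap.mulLeft O (SkewMonoidAlgebra.single 1 s)

/-- The `(A, C)`-bimodule `A i ⊗_{OP} C`. -/
abbrev indF : Type _ := BalTensor (D.rightP i) (D.leftP i)

/-- The left action of `A` on `A i ⊗_{OP} C`. -/
def actA (a : A) : Module.End O (D.indF i) :=
  BalTensor.map _ _ (Module.toModuleEnd O (D.Ai i) a) LinearMap.id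
    (fun s m => Subtype.ext (by simp [rightP, mul_assoc])) (fun _ _ => rfl)

/-- The right action of `C` on `A i ⊗_{OP} C`. -/
def actC (c : D.algC i) : Module.End O (D.indF i) :=
  BalTensor.map _ _ LinearMap.id (LinearMap.mulRight O c) (fun _ _ => rfl)
    (fun s n => by simp [leftP, mul_assoc])

/-- The `G/H`-grading of `A i ⊗_{OP} C`: here `C` is `G/H`-graded, with `u (φ, y)` of degree `ū y`
for `u ∈ P` and `(φ, y) ∈ F`, and `m ⊗ c` has degree `deg m · deg c`. -/
def indFGComp (x : G ⧸ H) : Submodule O (D.indF i) :=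
  Submodule.span O {n | ∃ (z : G ⧸ H) (u : P) (t : D.aFusion i), z * ((u : G) : G ⧸ H) * t.1.2 = x ∧
    ∃ m ∈ D.AiComp i z,
      n = BalTensor.tmul _ _ m (SkewMonoidAlgebra.single t (MonoidAlgebra.of O P u))}

/-- The `F`-grading of `A i ⊗_{OP} C`, coming from the `F`-grading of `C`. -/
def indFComp (t : D.aFusion i) : Submodule O (D.indF i) :=
  Submodule.span O {n | ∃ (m : D.Ai i) (s : MonoidAlgebra O P),
    n = BalTensor.tmul _ _ m (SkewMonoidAlgebra.single t s)}

/-- The algebra of the endomorphisms of `A i ⊗_{OP} C` that are left `A`-linear, right `C`-linear and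
preserve the `G/H`-grading. -/
def endF : Subalgebra O (Module.End O (D.indF i)) where
  carrier := {f | (∀ a n, f (D.actA i a n) = D.actA i a (f n)) ∧
    (∀ c n, f (D.actC i c n) = D.actC i c (f n)) ∧
    ∀ x, ∀ n ∈ D.indFGComp i x, f n ∈ D.indFGComp i x}
  mul_mem' := by
    rintro f h ⟨h1, h2, h3⟩ ⟨k1, k2, k3⟩
    exact ⟨fun a n => by simp [h1, k1], fun c n => by simp [h2, k2],
      fun x n hn => h3 x _ (k3 x n hn)⟩
  add_mem' := by
    rintro f h ⟨h1, h2, h3⟩ ⟨k1, k2, k3⟩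
    exact ⟨fun a n => by simp [h1, k1], fun c n => by simp [h2, k2],
      fun x n hn => add_mem (h3 x n hn) (k3 x n hn)⟩
  algebraMap_mem' r := ⟨fun a n => by simp, fun c n => by simp,
    fun x n hn => Submodule.smul_mem _ r hn⟩

/-- The algebra `𝓕 = End_{A-Gr ⊗ C^op} (A i ⊗_{OP} C)^op`. -/
abbrev calF : Type _ := (D.endF i)ᵐᵒᵖ

/-- The component of degree `t` of `𝓕`: the endomorphisms mapping the component of degree `x` of
`A i ⊗_{OP} C` to the one of degree `t⁻¹ x`, for all `x ∈ F`.  (The endomorphisms commute with the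
right action of `C`, so they multiply degrees on the left; the inverse makes the degree
multiplicative for the opposite product.) -/
def calFComp (t : D.aFusion i) : Submodule O (D.calF i) where
  carrier := {f | ∀ x, ∀ n ∈ D.indFComp i x, f.unop.1 n ∈ D.indFComp i (t⁻¹ * x)}
  add_mem' hf hh x n hn := add_mem (hf x n hn) (hh x n hn)
  zero_mem' _ _ _ := zero_mem _
  smul_mem' r _ hf x n hn := Submodule.smul_mem _ r (hf x n hn)

end AFusion

end GradedInterior

/-! ### Block extensions -/

/-- A `G`-invariant block of `OH`: a primitive idempotent `b` of the center of `OH` that is fixed by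
the conjugation action of `G`. -/
structure InvariantBlock (O : Type*) [CommRing O] {G : Type*} [Group G] (H : Subgroup G)
    [H.Normal] where
  /-- the block idempotent, in the center of `OH` -/
  b : Subring.center (MonoidAlgebra O H)
  primitive : IsPrimitiveIdem b
  invariant : ∀ g : G, MonoidAlgebra.domCongr O O (MulAut.conjNormal g : MulAut H)
    (b : MonoidAlgebra O H) = b

namespace InvariantBlock

variable {O : Type*} [CommRing O] {G : Type*} [Group G] {H : Subgroup G} [H.Normal]
  (β : InvariantBlock O H)

/-- The block idempotent `b`, regarded in `OG`. -/
def bG : MonoidAlgebra O G := MonoidAlgebra.mapDomainAlgHom O O H.subtype β.b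

theorem bG_idem : IsIdempotentElem β.bG := by
  have h : IsIdempotentElem (β.b : MonoidAlgebra O H) := congrArg Subtype.val β.primitive.idem
  exact h.map (MonoidAlgebra.mapDomainAlgHom O O H.subtype)

theorem of_mul_bG (g : G) : MonoidAlgebra.of O G g * β.bG = β.bG * MonoidAlgebra.of O G g := by
  have key : ∀ s : MonoidAlgebra O H,
      MonoidAlgebra.of O G g * MonoidAlgebra.mapDomainAlgHom O O H.subtype s =
      MonoidAlgebra.mapDomainAlgHom O O H.subtype
        (MonoidAlgebra.domCongr O O (MulAut.conjNormal g : MulAut H) s) *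
        MonoidAlgebra.of O G g := by
    intro s
    induction s using MonoidAlgebra.induction_on with
    | of h => simp
    | add x y hx hy => rw [map_add, map_add, map_add, add_mul, mul_add, hx, hy]
    | smul r x hx => rw [map_smul, map_smul, map_smul, smul_mul_assoc, mul_smul_comm, hx]
  rw [bG, key, β.invariant]

theorem bG_comm (r : MonoidAlgebra O G) : r * β.bG = β.bG * r := by
  induction r using MonoidAlgebra.induction_on with
  | of g => exact β.of_mul_bG g
  | add x y hx hy => rw [add_mul, mul_add, hx, hy]
  | smul r x hx => rw [smul_mul_assoc, mul_smul_comm, hx]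

/-- The block extension `A = OGb`, with identity element `b`. -/
abbrev Alg : Type _ := β.bG_idem.Corner

theorem mul_bG (a : β.Alg) : a.1 * β.bG = a.1 :=
  ((Subsemigroup.mem_corner_iff β.bG_idem).1 a.2).2

theorem bG_mul (a : β.Alg) : β.bG * a.1 = a.1 :=
  ((Subsemigroup.mem_corner_iff β.bG_idem).1 a.2).1

instance : Module O β.Alg where
  smul r a := ⟨r • a.1, (Subsemigroup.mem_corner_iff β.bG_idem).2
    ⟨by rw [mul_smul_comm, bG_mul], by rw [smul_mul_assoc, mul_bG]⟩⟩
  one_smul a := Subtype.ext (one_smul O a.1)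
  mul_smul r t a := Subtype.ext (mul_smul r t a.1)
  smul_zero r := Subtype.ext (smul_zero r)
  smul_add r a c := Subtype.ext (smul_add r a.1 c.1)
  add_smul r t a := Subtype.ext (add_smul r t a.1)
  zero_smul a := Subtype.ext (zero_smul O a.1)

instance : Algebra O β.Alg :=
  Algebra.ofModule (fun r a c => Subtype.ext (smul_mul_assoc r a.1 c.1))
    (fun r a c => Subtype.ext (mul_smul_comm r a.1 c.1))

/-- The inclusion of `OGb` in `OG`. -/
def incl : β.Alg →ₗ[O] MonoidAlgebra O G where
  toFun a := a.1
  map_add' _ _ := rfl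
  map_smul' _ _ := rfl

/-- The projection `r ↦ b r` of `OG` onto `OGb`. -/
def proj : MonoidAlgebra O G →ₗ[O] β.Alg where
  toFun r := ⟨β.bG * r, (Subsemigroup.mem_corner_iff β.bG_idem).2
    ⟨by rw [← mul_assoc, β.bG_idem.eq], by rw [mul_assoc, bG_comm, ← mul_assoc, β.bG_idem.eq]⟩⟩
  map_add' r t := Subtype.ext (mul_add _ r t)
  map_smul' c r := Subtype.ext (mul_smul_comm c _ r)

/-- The elements of `OGb` with support in the coset `x ∈ G/H`. -/
def comp (x : G ⧸ H) : Submodule O β.Alg where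
  carrier := {a | ∀ g : G, (β.incl a).coeff g ≠ 0 → (g : G ⧸ H) = x}
  add_mem' := by
    intro a c ha hc g hg
    by_contra hne
    have h1 : (β.incl a).coeff g = 0 := by by_contra h; exact hne (ha g h)
    have h2 : (β.incl c).coeff g = 0 := by by_contra h; exact hne (hc g h)
    exact hg (by simp [h1, h2])
  zero_mem' := by intro g hg; exact absurd (by simp) hg
  smul_mem' := by
    intro r a ha g hg
    refine ha g fun h => hg ?_
    simp [h]

theorem bG_supp (g : G) (hg : β.bG.coeff g ≠ 0) : (g : G ⧸ H) = 1 := by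
  rw [QuotientGroup.eq_one_iff]
  by_contra h
  apply hg
  have key : ∀ s : MonoidAlgebra O H,
      (MonoidAlgebra.mapDomainAlgHom O O H.subtype s).coeff g = 0 := by
    intro s
    induction s using MonoidAlgebra.induction_on with
    | of u =>
      have : (u : G) ≠ g := fun e => h (e ▸ u.2)
      simp [this]
    | add x y hx hy => rw [map_add, MonoidAlgebra.coeff_add, Finsupp.add_apply, hx, hy, add_zero]
    | smul r x hx => rw [map_smul, MonoidAlgebra.coeff_smul_apply, hx, smul_zero]
  exact key _

theorem mul_mem_comp {x y : G ⧸ H} {a c : β.Alg} (ha : a ∈ β.comp x) (hc : c ∈ β.comp y) :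
    a * c ∈ β.comp (x * y) := by
  classical
  intro g hg
  change (a.1 * c.1).coeff g ≠ 0 at hg
  rw [MonoidAlgebra.coeff_mul] at hg
  obtain ⟨g1, h1, hg⟩ := Finset.exists_ne_zero_of_sum_ne_zero hg
  obtain ⟨g2, h2, hg⟩ := Finset.exists_ne_zero_of_sum_ne_zero hg
  have e : g1 * g2 = g := by
    by_contra h
    simp [h] at hg
  rw [← e, QuotientGroup.mk_mul, ha g1 (Finsupp.mem_support_iff.1 h1),
    hc g2 (Finsupp.mem_support_iff.1 h2)]

theorem proj_of_mem (g : G) : β.proj (MonoidAlgebra.of O G g) ∈ β.comp (g : G ⧸ H) := by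
  intro h hh
  have e : (β.incl (β.proj (MonoidAlgebra.of O G g))).coeff h = β.bG.coeff (h * g⁻¹) := by
    change (β.bG * MonoidAlgebra.of O G g).coeff h = _
    rw [MonoidAlgebra.of_apply,
      MonoidAlgebra.coeff_mul_single_eq_coeff_mul (h * g⁻¹) fun _ _ => eq_mul_inv_iff_mul_eq.symm,
      mul_one]
  rw [e] at hh
  have := β.bG_supp _ hh
  rw [QuotientGroup.mk_mul, QuotientGroup.mk_inv, mul_inv_eq_one] at this
  exact this

theorem isAlgGrading_comp : IsAlgGrading O β.Alg β.comp where
  one_mem g hg := β.bG_supp g hg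
  mul_mem := β.mul_mem_comp
  indep := by
    rw [iSupIndep_def]
    intro x
    rw [Submodule.disjoint_def]
    intro a ha ha'
    let Z : Submodule O β.Alg :=
      { carrier := {a | ∀ g : G, (g : G ⧸ H) = x → (β.incl a).coeff g = 0}
        add_mem' := fun {a c} h1 h2 g hg => by simp [h1 g hg, h2 g hg]
        zero_mem' := fun g _ => by simp
        smul_mem' := fun r a h1 g hg => by simp [h1 g hg] }
    have hZ : (⨆ y, ⨆ (_ : y ≠ x), β.comp y) ≤ Z := by
      refine iSup₂_le fun y hy c hc g hg => ?_
      by_contra h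
      exact hy ((hc g h).symm.trans hg)
    have hz := hZ ha'
    apply Subtype.ext
    change β.incl a = 0
    ext g
    by_contra h
    exact h (hz g (ha g h))
  iSup_eq_top := by
    rw [eq_top_iff]
    intro a _
    have key : ∀ r : MonoidAlgebra O G, β.proj r ∈ ⨆ x, β.comp x := by
      intro r
      induction r using MonoidAlgebra.induction_on with
      | of g => exact Submodule.mem_iSup_of_mem _ (β.proj_of_mem g)
      | add x y hx hy => rw [map_add]; exact add_mem hx hy
      | smul r x hx => rw [map_smul]; exact Submodule.smul_mem _ _ hx
    have e : β.proj a.1 = a := Subtype.ext (β.bG_mul a)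
    rw [← e]
    exact key _

/-- The block extension `A = OGb` as a `G/H`-graded `G`-interior algebra: the component of degree
`x ∈ G/H` consists of the elements supported in the coset `x`, so that the identity component is
`B = OHb`, and the structural map sends `g` to `g b`. -/
def ext : GradedInterior O H β.Alg where
  comp := β.comp
  grading := β.isAlgGrading_comp
  σ :=
    { toFun := fun g => β.proj (MonoidAlgebra.of O G g)
      map_one' := Subtype.ext (by
        change β.bG * MonoidAlgebra.of O G 1 = β.bG
        rw [map_one, mul_one])
      map_mul' := fun g h => Subtype.ext (by
        change β.bG * MonoidAlgebra.of O G (g * h) =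
          β.bG * MonoidAlgebra.of O G g * (β.bG * MonoidAlgebra.of O G h)
        rw [map_mul, mul_assoc β.bG, ← mul_assoc _ β.bG, of_mul_bG, ← mul_assoc, ← mul_assoc,
          ← mul_assoc, β.bG_idem.eq]) }
  σ_mem := β.proj_of_mem

end InvariantBlock

end

open scoped TensorProduct

noncomputable section

/-! ### Finite algebras over a complete local ring -/

section AdicFinite

/-! Both algebras are described by the same family of subspaces of A. For a pair t = (φ, y) let W_t
(`fusionSpace`) consist of those a ∈ iAi of degree y with φ(u)a = au for all u ∈ P. These subspaces
multiply as W_s W_t ⊆ W_{st}, so the elements of a group algebra A[Γ] whose coefficient at each t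
lies in W_t form an algebra with identity i. `IsCoeffModel` expresses that a given algebra is of
this kind.

On the side of 𝓔, the induced module is generated by 1 ⊗ i and embeds in A[E] by (s ⊗ g) ⊗ m ↦ s ᵍm
g placed at the class of g. An endomorphism is right multiplication by the image of the generator,
and the coefficients of that image are exactly the elements of W. On the side of 𝓕, the bimodule is
generated by i ⊗ 1 and embeds in A[F] by m ⊗ st ↦ ms placed at t⁻¹. Again endomorphisms become right
multiplications: A- and C-linearity give the relation φ(u)a = au, and preservation of the Ḡ-grading
gives the degree of a. In both cases passing to the opposite algebra makes the coefficient map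
multiplicative. Hence any group isomorphism θ : E → F under which the two families of W correspond
induces a graded isomorphism (`IsCoeffModel.exists_algEquiv`).

It remains to see that conjugation is an isomorphism E → F. By `fusionIso_iff`, (φ, y) lies in F
when y transforms the classes of u as φ does and some element of W_(φ,y) has a two-sided inverse,
relative to i, in W_(φ⁻¹,y⁻¹). If g stabilizes γ, correcting g by a unit of B^P that carries ᵍi to i
gives such an element. Conversely, let dd' = d'd = i with d of degree y⁻¹. The coefficients of d in
the group basis are constant on the orbits of P acting by g ↦ u g φ(u)⁻¹, so dd' is a combination of
relative traces from the stabilizers. As i is not in the kernel of the Brauer homomorphism, some g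
in the coset y⁻¹ is fixed by P (`exists_mem_support`). Then g⁻¹ induces φ, and dg⁻¹ and gd' show
that i and ᵍi are associated in B^P. Associated primitive idempotents are conjugate there
(`IsPrimitiveIdem.isConj_of_assoc`), because B^P is finite over a complete local ring and so the
corner of a primitive idempotent is local. Thus g⁻¹ stabilizes γ. -/

theorem IsPrecomplete.of_moduleFinite {O : Type*} [CommRing O] (I : Ideal O) [IsPrecomplete I O]
    (M : Type*) [AddCommGroup M] [Module O M] [Module.Finite O M] : IsPrecomplete I M := by
  rw [← AdicCompletion.of_surjective_iff]
  intro x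
  -- The completion of M is an image of the completion of `O` tensored with M, so only scalars have
  -- to be lifted.
  obtain ⟨t, rfl⟩ := AdicCompletion.ofTensorProduct_surjective_of_finite I M x
  induction t using TensorProduct.induction_on with
  | zero => exact ⟨0, by simp⟩
  | add a b ha hb =>
    obtain ⟨m, hm⟩ := ha
    obtain ⟨n, hn⟩ := hb
    exact ⟨m + n, by rw [map_add, map_add, hm, hn]⟩
  | tmul r m =>
    obtain ⟨r, rfl⟩ := AdicCompletion.of_surjective I O r
    refine ⟨r • m, ?_⟩
    rw [AdicCompletion.ofTensorProduct_tmul]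
    ext n
    rw [AdicCompletion.of_apply]
    simp
    rfl

open Polynomial in
theorem HenselianRing.exists_isIdempotentElem {R : Type*} [CommRing R] (I : Ideal R)
    [HenselianRing R I] {a : R} (ha : a * a - a ∈ I) : ∃ q, IsIdempotentElem q ∧ q - a ∈ I := by
  obtain ⟨q, hq, hqa⟩ := HenselianRing.is_henselian (I := I) (X * (X - C 1) : R[X])
    (monic_X.mul (monic_X_sub_C 1)) a (by simpa [mul_sub] using ha) (by
      -- The derivative 2a - 1 is its own inverse modulo I, since (2a - 1)² - 1 = 4(a² - a).
      refine IsUnit.of_mul_eq_one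
        (Ideal.Quotient.mk I (derivative (X * (X - C 1) : R[X]) |>.eval a)) ?_
      rw [← map_mul, ← map_one (Ideal.Quotient.mk I), Ideal.Quotient.eq]
      convert I.mul_mem_left 4 ha using 1
      simp
      ring)
  refine ⟨q, ?_, hqa⟩
  rw [IsIdempotentElem]
  simpa [-mul_eq_zero, IsRoot, mul_sub, sub_eq_zero] using hq

variable {O : Type*} [CommRing O] [IsLocalRing O] [IsNoetherianRing O]
  [IsAdicComplete (IsLocalRing.maximalIdeal O) O]

theorem isAdicComplete_map_maximalIdeal (R : Type*) [CommRing R] [Algebra O R]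
    [Module.Finite O R] :
    IsAdicComplete ((IsLocalRing.maximalIdeal O).map (algebraMap O R)) R := by
  rw [IsAdicComplete.map_algebraMap_iff]
  have := IsPrecomplete.of_moduleFinite (IsLocalRing.maximalIdeal O) R
  exact { }

/-- An idempotent `e` of a finite commutative algebra over a complete local ring that dominates only
the trivial idempotents cuts out a local ring. -/
theorem exists_mul_eq_idem_of_comm {R : Type*} [CommRing R] [Algebra O R] [Module.Finite O R]
    {e : R} (he : IsIdempotentElem e)
    (h : ∀ q : R, IsIdempotentElem q → q * e = 0 ∨ q * e = e) (a : R) :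
    (∃ c, a * c * e = e) ∨ ∃ c, (1 - a) * c * e = e := by
  set I := (IsLocalRing.maximalIdeal O).map (algebraMap O R) with hI
  have hc : IsAdicComplete I R := isAdicComplete_map_maximalIdeal R
  have hart : IsArtinianRing (R ⧸ I) := by
    let := Ideal.Quotient.field (IsLocalRing.maximalIdeal O)
    have : Module.Finite (O ⧸ IsLocalRing.maximalIdeal O) (R ⧸ I) :=
      Module.Finite.of_restrictScalars_finite O _ _
    exact IsArtinianRing.of_finite (O ⧸ IsLocalRing.maximalIdeal O) _
  have unit_of_mem : ∀ x ∈ I, IsUnit (1 - x) := fun x hx => by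
    have := Ideal.mem_jacobson_bot.1 (IsAdicComplete.le_jacobson_bot I hx) (-1)
    simpa [sub_eq_neg_add] using this
  -- Fitting's argument: modulo I the powers of a stabilize, so aⁿ⁺¹y ≡ aⁿ.
  obtain ⟨n, y, hy⟩ := IsArtinian.exists_pow_succ_smul_dvd (Ideal.Quotient.mk I a) (1 : R ⧸ I)
  obtain ⟨y, rfl⟩ := Ideal.Quotient.mk_surjective y
  simp only [smul_eq_mul, Nat.succ_eq_add_one, mul_one] at hy
  have key : ∀ m : ℕ, Ideal.Quotient.mk I (a ^ (n + 1) * (a * y) ^ m) =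
      Ideal.Quotient.mk I (a ^ (n + 1)) := by
    intro m
    induction m with
    | zero => simp
    | succ m ih =>
      calc _ = Ideal.Quotient.mk I (a ^ (n + 1) * (a * y) ^ m) * Ideal.Quotient.mk I (a * y) := by
            rw [← map_mul]; congr 1; ring
        _ = Ideal.Quotient.mk I a * (Ideal.Quotient.mk I a ^ (n + 1) * Ideal.Quotient.mk I y) := by
            rw [ih, map_mul, map_pow]; ring
        _ = _ := by rw [hy, map_pow, pow_succ']
  -- The exponent is n + 1 rather than n so that this idempotent modulo I is divisible by a even
  -- when n = 0.
  have hq0 : (a * y) ^ (n + 1) * (a * y) ^ (n + 1) - (a * y) ^ (n + 1) ∈ I := by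
    rw [← Ideal.Quotient.eq]
    have := congrArg (· * Ideal.Quotient.mk I (y ^ (n + 1))) (key (n + 1))
    simp only [← map_mul] at this
    convert this using 2 <;> ring
  obtain ⟨q, hq, hq1⟩ := HenselianRing.exists_isIdempotentElem I hq0
  rcases h q hq with h0 | h1
  -- Here a is nilpotent modulo I on the part cut out by e, and the geometric series inverts 1 - a
  -- up to the unit 1 - aⁿ⁺¹e.
  · right
    have hm : a ^ (n + 1) * e ∈ I := by
      have h2 : a ^ (n + 1) * (1 - (a * y) ^ (n + 1)) ∈ I := by
        have := Ideal.Quotient.eq.1 (key (n + 1))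
        rw [← neg_mem_iff]
        convert this using 1; ring
      have : a ^ (n + 1) * e = e * (a ^ (n + 1) * (1 - (a * y) ^ (n + 1))) -
          a ^ (n + 1) * e * (q - (a * y) ^ (n + 1)) + a ^ (n + 1) * (q * e) := by ring
      rw [this, h0, mul_zero, add_zero]
      exact sub_mem (I.mul_mem_left _ h2) (I.mul_mem_left _ hq1)
    obtain ⟨v, hv⟩ := unit_of_mem _ hm
    refine ⟨(∑ k ∈ Finset.range (n + 1), a ^ k) * ↑v⁻¹, ?_⟩
    have hg : (1 - a) * ∑ k ∈ Finset.range (n + 1), a ^ k = 1 - a ^ (n + 1) := mul_neg_geom_sum a _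
    have hv' : (1 - a ^ (n + 1)) * e = v * e := by
      rw [hv, sub_mul, sub_mul, mul_assoc, he.eq]
    calc _ = ((1 - a) * ∑ k ∈ Finset.range (n + 1), a ^ k) * e * ↑v⁻¹ := by ring
      _ = (v * ↑v⁻¹) * e := by rw [hg, hv']; ring
      _ = e := by simp
  -- Here (ay)ⁿ⁺¹ agrees with the identity modulo I on the part cut out by e, so a is invertible
  -- there.
  · left
    have hm : e - (a * y) ^ (n + 1) * e ∈ I := by
      have : e - (a * y) ^ (n + 1) * e = (q - (a * y) ^ (n + 1)) * e := by
        rw [sub_mul, h1]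
      rw [this]
      exact I.mul_mem_right _ hq1
    obtain ⟨v, hv⟩ := unit_of_mem _ hm
    refine ⟨a ^ n * y ^ (n + 1) * ↑v⁻¹, ?_⟩
    have hv' : (a * y) ^ (n + 1) * e = v * e := by
      rw [hv, sub_mul, sub_mul, mul_assoc, he.eq]; ring
    calc _ = (a * y) ^ (n + 1) * e * ↑v⁻¹ := by ring
      _ = (v * ↑v⁻¹) * e := by rw [hv']; ring
      _ = e := by simp

/-- The corner of a primitive idempotent of a finite algebra over a complete local ring is local. -/
theorem IsPrimitiveIdem.exists_inv_or {S : Type*} [Ring S] [Algebra O S] [Module.Finite O S]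
    {e : S} (he : IsPrimitiveIdem e) {a : S} (ha : e * a = a) (ha' : a * e = a) :
    (∃ c, e * c = c ∧ c * e = c ∧ a * c = e ∧ c * a = e) ∨
    ∃ c, e * c = c ∧ c * e = c ∧ (e - a) * c = e ∧ c * (e - a) = e := by
  have hcomm : ∀ x ∈ ({a, e} : Set S), ∀ y ∈ ({a, e} : Set S), x * y = y * x := by
    rintro x (rfl | rfl) y (rfl | rfl) <;> simp [ha, ha']
  have := Algebra.isMulCommutative_adjoin O hcomm
  -- Since a and e commute, the commutative case applies to the subalgebra they generate, which is
  -- finite because `O` is Noetherian.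
  let R := Algebra.adjoin O ({a, e} : Set S)
  let : CommRing R := { (inferInstance : Ring R) with mul_comm := fun x y => mul_comm' x y }
  have hfin : Module.Finite O R :=
    have := isNoetherian_of_isNoetherianRing_of_finite O S
    Module.IsNoetherian.finite O (Subalgebra.toSubmodule R)
  have hmem : ∀ x ∈ ({a, e} : Set S), x ∈ R := fun x hx => Algebra.subset_adjoin hx
  let a' : R := ⟨a, hmem a (by simp)⟩
  let e' : R := ⟨e, hmem e (by simp)⟩
  have he' : IsIdempotentElem e' := Subtype.ext he.idem
  have hR : ∀ x : R, (x : S) * e = e * x := fun x => congrArg Subtype.val (mul_comm x e')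
  have hRa : ∀ x : R, (x : S) * a = a * x := fun x => congrArg Subtype.val (mul_comm x a')
  rcases exists_mul_eq_idem_of_comm (O := O) he' (fun q hq => by
    rcases he.eq_or (q * e' : R) (congrArg Subtype.val (hq.mul he'))
      (congrArg Subtype.val (show e' * (q * e') = q * e' by rw [mul_left_comm, he'.eq]))
      (congrArg Subtype.val (show q * e' * e' = q * e' by rw [mul_assoc, he'.eq])) with h | h
    · exact Or.inl (Subtype.ext h)
    · exact Or.inr (Subtype.ext h)) a' with ⟨c, hc⟩ | ⟨c, hc⟩
  · left
    have hc : a * c * e = e := congrArg Subtype.val hc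
    refine ⟨c * e, ?_, ?_, ?_, ?_⟩
    · rw [← mul_assoc, ← hR, mul_assoc, he.idem]
    · rw [mul_assoc, he.idem]
    · rw [← mul_assoc, hc]
    · rw [mul_assoc, ha, hRa, ← ha', mul_assoc, ← hR, ← mul_assoc, hc]
  · right
    have hc : (1 - a) * c * e = e := congrArg Subtype.val hc
    have h1 : (e - a) * (c * e) = e := by
      have : e - a = e * (1 - a) := by rw [mul_sub, ha, mul_one]
      rw [this, mul_assoc, ← mul_assoc _ _ e, hc, he.idem]
    refine ⟨c * e, ?_, ?_, h1, ?_⟩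
    · rw [← mul_assoc, ← hR, mul_assoc, he.idem]
    · rw [mul_assoc, he.idem]
    · have : c * e * (e - a) = (e - a) * (c * e) :=
        congrArg Subtype.val (mul_comm (c * e') (e' - a'))
      rw [this, h1]

end AdicFinite

/-! ### Conjugacy of associated primitive idempotents -/

section Conj

variable {S : Type*} [Ring S] {e f : S}

/-- The hypotheses say that Se = Sf. Then (f - e)² = 0, and the unit 1 + (f - e) conjugates e to f.
-/
theorem isConj_of_mul_eq_left (he : IsIdempotentElem e) (hf : IsIdempotentElem f)
    (h : e * f = e) (h' : f * e = f) : IsConj e f := by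
  have hN : (f - e) * (f - e) = 0 := by
    simp [mul_sub, sub_mul, he.eq, hf.eq, h, h']
  refine ⟨⟨1 + (f - e), 1 - (f - e), ?_, ?_⟩, ?_⟩
  · rw [mul_sub, add_mul _ _ (_ - _), hN]; simp
  · rw [mul_add, sub_mul _ _ (_ - _), hN]; simp
  · change (1 + (f - e)) * e = f * (1 + (f - e))
    simp [mul_add, mul_sub, add_mul, sub_mul, he.eq, hf.eq, h']

theorem isConj_of_mul_eq_right (he : IsIdempotentElem e) (hf : IsIdempotentElem f)
    (h : e * f = f) (h' : f * e = e) : IsConj e f := by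
  have hN : (e - f) * (e - f) = 0 := by
    simp [mul_sub, sub_mul, he.eq, hf.eq, h, h']
  refine ⟨⟨1 + (e - f), 1 - (e - f), ?_, ?_⟩, ?_⟩
  · rw [mul_sub, add_mul _ _ (_ - _), hN]; simp
  · rw [mul_add, sub_mul _ _ (_ - _), hN]; simp
  · change (1 + (e - f)) * e = f * (1 + (e - f))
    simp [mul_add, mul_sub, add_mul, sub_mul, he.eq, hf.eq, h']

/-- If `e g e` is invertible in `e S e`, with inverse `c`, then `e` is conjugate to the idempotent
`g c g`. -/
theorem isConj_corner_inv (he : IsIdempotentElem e) {g c : S} (hg : IsIdempotentElem g)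
    (hc : e * c = c) (hc' : c * e = c) (h2 : c * (e * g * e) = e) :
    IsIdempotentElem (g * c * g) ∧ IsConj e (g * c * g) := by
  have h3 : c * g * c = c := by
    calc c * g * c = c * (e * g * e) * c := by
          simp only [← mul_assoc, hc']; rw [mul_assoc (c * g), hc]
      _ = c := by rw [h2, hc]
  have h4 : c * g * e = e := by
    calc c * g * e = c * (e * g * e) := by simp only [← mul_assoc, hc']
      _ = e := h2
  have hI : IsIdempotentElem (g * c * g) := by
    change g * c * g * (g * c * g) = g * c * g
    calc _ = g * (c * (g * g) * c) * g := by simp only [mul_assoc]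
      _ = _ := by rw [hg.eq, h3]
  have hJ : IsIdempotentElem (c * g) := by
    change c * g * (c * g) = c * g
    rw [← mul_assoc, h3]
  -- The idempotent cg links the two: it generates the same right ideal as e and the same left ideal
  -- as gcg.
  refine ⟨hI, (isConj_of_mul_eq_right he hJ (by rw [← mul_assoc, hc]) h4).trans
    (isConj_of_mul_eq_left hJ hI ?_ ?_)⟩
  · calc c * g * (g * c * g) = c * (g * g) * c * g := by simp only [mul_assoc]
      _ = c * g := by rw [hg.eq, h3]
  · calc g * c * g * (c * g) = g * (c * g * c) * g := by simp only [mul_assoc]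
      _ = g * c * g := by rw [h3]

/-- Orthogonal associated idempotents are conjugate. -/
theorem isConj_of_orthogonal {x y : S} (hef : e * f = 0) (hfe : f * e = 0)
    (hx : e * x = x) (hx' : x * f = x) (hy : f * y = y) (hy' : y * e = y)
    (hxy : x * y = e) (hyx : y * x = f) : IsConj e f := by
  have he : e * e = e := by
    conv_rhs => rw [← hxy, ← hx, mul_assoc, hxy]
  have hf : f * f = f := by
    conv_rhs => rw [← hyx, ← hy, mul_assoc, hyx]
  have hxx : x * x = 0 := by
    calc x * x = x * f * (e * x) := by rw [hx, hx']
      _ = x * (f * e) * x := by simp only [mul_assoc]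
      _ = 0 := by rw [hfe, mul_zero, zero_mul]
  have hyy : y * y = 0 := by
    calc y * y = y * e * (f * y) := by rw [hy, hy']
      _ = y * (e * f) * y := by simp only [mul_assoc]
      _ = 0 := by rw [hef, mul_zero, zero_mul]
  have hex : x * e = 0 := by rw [← hx', mul_assoc, hfe, mul_zero]
  have hfx : f * x = 0 := by rw [← hx, ← mul_assoc, hfe, zero_mul]
  have hey : e * y = 0 := by rw [← hy, ← mul_assoc, hef, zero_mul]
  have hyf : y * f = 0 := by rw [← hy', mul_assoc, hef, mul_zero]
  -- This involution interchanges e and f and is the identity on the complement 1 - e - f.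
  have hu : (x + y + (1 - e - f)) * (x + y + (1 - e - f)) = 1 := by
    simp only [add_mul, mul_add, sub_mul, mul_sub, hxx, hyy, hxy, hyx, hx, hx', hy, hy', hex, hfx,
      hey, hyf, he, hf, hef, hfe, mul_one, one_mul]
    abel
  refine ⟨⟨_, _, hu, hu⟩, ?_⟩
  change (x + y + (1 - e - f)) * e = f * (x + y + (1 - e - f))
  simp only [add_mul, mul_add, sub_mul, mul_sub, hy, hy', hex, hfx, he, hf, hfe, mul_one,
    one_mul]
  abel

/-- The map q ↦ xqy carries idempotents below f to idempotents below e, and r ↦ yrx undoes it. -/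
theorem IsPrimitiveIdem.of_assoc (he : IsPrimitiveIdem e) {x y : S} (hx : e * x = x)
    (hy : f * y = y) (hy' : y * e = y) (hxy : x * y = e) (hyx : y * x = f) :
    IsPrimitiveIdem f where
  ne_zero h := he.ne_zero (by rw [← hxy, ← hy, h, zero_mul, mul_zero])
  idem := by
    change f * f = f
    calc f * f = y * (x * y) * x := by rw [← hyx]; simp only [mul_assoc]
      _ = f := by rw [hxy, hy', hyx]
  eq_or q hq h1 h2 := by
    have hq' : y * (x * q * y) * x = q := by
      calc y * (x * q * y) * x = y * x * q * (y * x) := by simp only [mul_assoc]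
        _ = q := by rw [hyx, h1, h2]
    have hidem : IsIdempotentElem (x * q * y) := by
      change x * q * y * (x * q * y) = x * q * y
      calc x * q * y * (x * q * y) = x * (q * (y * x) * q) * y := by simp only [mul_assoc]
        _ = x * q * y := by rw [hyx, h2, hq.eq]
    rcases he.eq_or _ hidem (by simp only [← mul_assoc, hx]) (by simp only [mul_assoc, hy'])
      with h | h
    · left
      rw [← hq', h, mul_zero, zero_mul]
    · right
      rw [← hq', h, hy', hyx]

theorem IsPrimitiveIdem.of_isConj (he : IsPrimitiveIdem e) (h : IsConj e f) :
    IsPrimitiveIdem f := by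
  obtain ⟨c, hc⟩ := h
  have hc : (c : S) * e = f * c := hc
  have hee := he.idem.eq
  have hf : f = c * e * ↑c⁻¹ := by rw [hc]; simp
  refine he.of_assoc (x := e * ↑c⁻¹) (y := c * e) (by rw [← mul_assoc, hee]) ?_
    (by rw [mul_assoc, hee]) (by simp [mul_assoc, hee]) ?_
  · rw [← mul_assoc, ← hc, mul_assoc, hee]
  · rw [hf, mul_assoc, ← mul_assoc e, hee, mul_assoc]

/-- In a finite algebra over a complete local ring, associated primitive idempotents are
conjugate. -/
theorem IsPrimitiveIdem.isConj_of_assoc {O : Type*} [CommRing O] [IsLocalRing O]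
    [IsNoetherianRing O] [IsAdicComplete (IsLocalRing.maximalIdeal O) O] [Algebra O S]
    [Module.Finite O S] (he : IsPrimitiveIdem e) {x y : S} (hx : e * x = x) (hx' : x * f = x)
    (hy : f * y = y) (hy' : y * e = y)
    (hxy : x * y = e) (hyx : y * x = f) : IsConj e f := by
  have hf := he.of_assoc hx hy hy' hxy hyx
  have hee := he.idem.eq
  have hff := hf.idem.eq
  -- In the local ring eSe one of efe and e - efe = e(1 - f)e is invertible. In the first case e is
  -- conjugate to an idempotent below f, which is f by primitivity.
  rcases he.exists_inv_or (O := O) (a := e * f * e) (by simp only [← mul_assoc, hee])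
    (by simp only [mul_assoc, hee]) with ⟨c, h1, h2, h3, h4⟩ | ⟨c, h1, h2, h3, h4⟩
  · obtain ⟨hI, hconj⟩ := isConj_corner_inv he.idem hf.idem h1 h2 h4
    rcases hf.eq_or _ hI (by simp only [← mul_assoc, hff]) (by simp only [mul_assoc, hff])
      with h | h
    · obtain ⟨u, hu⟩ := hconj
      have hu : (u : S) * e = (f * c * f) * u := hu
      exact absurd (by simpa [h] using hu) he.ne_zero
    · rwa [h] at hconj
  -- In the second case e is conjugate to an idempotent g below 1 - f. It is orthogonal to f and
  -- still associated with f, so the interchanging involution applies.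
  · have hg : IsIdempotentElem (1 - f) := hf.idem.one_sub
    have hege : e * (1 - f) * e = e - e * f * e := by rw [mul_sub, sub_mul, mul_one, hee]
    rw [← hege] at h4
    obtain ⟨hI, u, hu⟩ := isConj_corner_inv he.idem hg h1 h2 h4
    set g := (1 - f) * c * (1 - f)
    have hu1 : (u : S) * e = g * u := hu
    have hfg : f * g = 0 := by simp only [g, ← mul_assoc, mul_sub, hff]; simp
    have hgf : g * f = 0 := by simp only [g, mul_assoc, sub_mul, hff]; simp
    have hg' : g = u * e * ↑u⁻¹ := by rw [hu1]; simp
    refine IsConj.trans ⟨u, hu⟩ (isConj_of_orthogonal (x := u * x) (y := y * ↑u⁻¹) hgf hfg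
      ?_ ?_ ?_ ?_ ?_ ?_)
    · rw [← mul_assoc, ← hu1, mul_assoc, hx]
    · rw [mul_assoc, hx']
    · rw [← mul_assoc, hy]
    · rw [hg']; simp [← mul_assoc, hy']
    · rw [hg', ← hxy]; simp only [mul_assoc]
    · rw [← hyx]; simp [mul_assoc]

end Conj

/-! ### Algebras of graded families -/

theorem MonoidAlgebra.mul_coeff_of_single_one_mul {A Γ : Type*} [Ring A] [Group Γ] {i : A}
    {z : MonoidAlgebra A Γ} (h : MonoidAlgebra.single 1 i * z = z) (t : Γ) :
    i * z.coeff t = z.coeff t := by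
  rw [← MonoidAlgebra.coeff_single_one_mul, h]

theorem MonoidAlgebra.coeff_mul_of_mul_single_one {A Γ : Type*} [Ring A] [Group Γ] {i : A}
    {z : MonoidAlgebra A Γ} (h : z * MonoidAlgebra.single 1 i = z) (t : Γ) :
    z.coeff t * i = z.coeff t := by
  rw [← MonoidAlgebra.coeff_mul_single_one, h]

/-- The linear map `Λ` identifies the `O`-algebra `R` with the algebra of the elements of the group
algebra of `Γ` over `A` whose coefficient at each `t ∈ Γ` lies in `W t`; its identity element is the
idempotent `i` of `A`. -/
structure IsCoeffModel {O A R Γ : Type*} [CommRing O] [Ring A] [Algebra O A] [Ring R] [Algebra O R]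
    [Group Γ] (W : Γ → Submodule O A) (i : A) (Λ : R →ₗ[O] MonoidAlgebra A Γ) : Prop where
  injective : Function.Injective Λ
  map_one : Λ 1 = MonoidAlgebra.single 1 i
  map_mul : ∀ x y, Λ (x * y) = Λ x * Λ y
  coeff_mem : ∀ x t, (Λ x).coeff t ∈ W t
  exists_single : ∀ t, ∀ a ∈ W t, ∃ x, Λ x = MonoidAlgebra.single t a

namespace IsCoeffModel

variable {O A R R' Γ Γ' : Type*} [CommRing O] [Ring A] [Algebra O A] [Ring R] [Algebra O R]
    [Ring R'] [Algebra O R'] [Group Γ] [Group Γ'] {W : Γ → Submodule O A} {i : A}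
    {Λ : R →ₗ[O] MonoidAlgebra A Γ}

/-- Since every admissible one-term element already comes from 𝒜 t, injectivity of Λ turns two
one-sided checks into a characterization of the component. -/
theorem mem_iff (h : IsCoeffModel W i Λ) {𝒜 : Γ → Submodule O R}
    (h1 : ∀ t, ∀ x ∈ 𝒜 t, ∃ a, Λ x = MonoidAlgebra.single t a)
    (h2 : ∀ t, ∀ a ∈ W t, ∃ x ∈ 𝒜 t, Λ x = MonoidAlgebra.single t a) (t : Γ) (x : R) :
    x ∈ 𝒜 t ↔ ∃ a, Λ x = MonoidAlgebra.single t a := by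
  refine ⟨h1 t x, ?_⟩
  rintro ⟨a, ha⟩
  obtain ⟨y, hy, hya⟩ := h2 t a (by simpa [ha] using h.coeff_mem x t)
  rwa [h.injective (ha.trans hya.symm)]

theorem isAlgGrading (h : IsCoeffModel W i Λ) {𝒜 : Γ → Submodule O R}
    (h𝒜 : ∀ t x, x ∈ 𝒜 t ↔ ∃ a, Λ x = MonoidAlgebra.single t a) : IsAlgGrading O R 𝒜 where
  one_mem := (h𝒜 _ _).2 ⟨i, h.map_one⟩
  mul_mem := by
    intro s t x y hx hy
    obtain ⟨a, ha⟩ := (h𝒜 _ _).1 hx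
    obtain ⟨c, hc⟩ := (h𝒜 _ _).1 hy
    exact (h𝒜 _ _).2 ⟨a * c, by rw [h.map_mul, ha, hc, MonoidAlgebra.single_mul_single]⟩
  indep := by
    rw [iSupIndep_def]
    intro t
    rw [Submodule.disjoint_def]
    intro x hx hx'
    let Z : Submodule O R :=
      { carrier := {x | (Λ x).coeff t = 0}
        add_mem' := fun {x y} hx hy => by
          change (Λ (x + y)).coeff t = 0
          rw [map_add, MonoidAlgebra.coeff_add, Finsupp.add_apply, hx, hy, add_zero]
        zero_mem' := by
          change (Λ 0).coeff t = 0
          simp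
        smul_mem' := fun r x hx => by
          change (Λ (r • x)).coeff t = 0
          rw [map_smul, MonoidAlgebra.coeff_smul_apply, hx, smul_zero] }
    have hZ : (⨆ s, ⨆ (_ : s ≠ t), 𝒜 s) ≤ Z := by
      refine iSup₂_le fun s hs y hy => ?_
      obtain ⟨a, ha⟩ := (h𝒜 _ _).1 hy
      change (Λ y).coeff t = 0
      rw [ha, MonoidAlgebra.coeff_single, Finsupp.single_eq_of_ne hs.symm]
    have hz : (Λ x).coeff t = 0 := hZ hx'
    obtain ⟨a, ha⟩ := (h𝒜 _ _).1 hx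
    rw [ha, MonoidAlgebra.coeff_single, Finsupp.single_eq_same] at hz
    apply h.injective
    rw [ha, hz, map_zero, MonoidAlgebra.single_zero]
  iSup_eq_top := by
    rw [eq_top_iff]
    intro x _
    choose y hy using fun t => h.exists_single t _ (h.coeff_mem x t)
    have : x = ∑ t ∈ (Λ x).coeff.support, y t := by
      apply h.injective
      rw [map_sum]
      simp only [hy]
      exact (MonoidAlgebra.sum_coeff_single (Λ x)).symm
    rw [this]
    exact sum_mem fun t _ => Submodule.mem_iSup_of_mem t ((h𝒜 _ _).2 ⟨_, hy t⟩)

theorem mem_range_iff (h : IsCoeffModel W i Λ) (z : MonoidAlgebra A Γ) :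
    z ∈ LinearMap.range Λ ↔ ∀ t, z.coeff t ∈ W t := by
  constructor
  · rintro ⟨x, rfl⟩ t
    exact h.coeff_mem x t
  · intro hz
    rw [← MonoidAlgebra.sum_coeff_single z]
    refine sum_mem fun t _ => ?_
    obtain ⟨x, hx⟩ := h.exists_single t _ (hz t)
    exact ⟨x, hx⟩

/-- Models of the same graded family are isomorphic. -/
theorem exists_algEquiv (h : IsCoeffModel W i Λ) (θ : Γ ≃* Γ') {W' : Γ' → Submodule O A}
    (hW : ∀ t, W t = W' (θ t)) {Λ' : R' →ₗ[O] MonoidAlgebra A Γ'} (h' : IsCoeffModel W' i Λ')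
    {𝒜 : Γ → Submodule O R} (h𝒜 : ∀ t x, x ∈ 𝒜 t ↔ ∃ a, Λ x = MonoidAlgebra.single t a)
    {𝒜' : Γ' → Submodule O R'} (h𝒜' : ∀ t x, x ∈ 𝒜' t ↔ ∃ a, Λ' x = MonoidAlgebra.single t a) :
    ∃ Ψ : R ≃ₐ[O] R', ∀ t, (𝒜 t).map Ψ.toLinearMap = 𝒜' (θ t) := by
  let T : MonoidAlgebra A Γ ≃ₐ[O] MonoidAlgebra A Γ' := MonoidAlgebra.domCongr O A θ
  have hTc : ∀ z t, (T z).coeff (θ t) = z.coeff t := fun z t => by simp [T]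
  have hTs : ∀ t a, T (MonoidAlgebra.single t a) = MonoidAlgebra.single (θ t) a := fun t a => by
    simp [T]
  let L : R →ₗ[O] MonoidAlgebra A Γ' := T.toLinearMap ∘ₗ Λ
  have hL : Function.Injective L := T.injective.comp h.injective
  -- After relabelling Γ by θ, both images are the set of all elements with coefficients in W'.
  have hrange : LinearMap.range L = LinearMap.range Λ' := by
    ext z
    rw [h'.mem_range_iff]
    constructor
    · rintro ⟨x, rfl⟩ t
      obtain ⟨t, rfl⟩ := θ.surjective t
      change (T (Λ x)).coeff (θ t) ∈ W' (θ t)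
      rw [hTc, ← hW]
      exact h.coeff_mem x t
    · intro hz
      obtain ⟨z, rfl⟩ := T.surjective z
      obtain ⟨x, hx⟩ := (h.mem_range_iff z).2 fun t => by
        rw [hW, ← hTc]
        exact hz (θ t)
      exact ⟨x, congrArg T hx⟩
  let Ψ : R ≃ₗ[O] R' := (LinearEquiv.ofInjective L hL).trans
    ((LinearEquiv.ofEq _ _ hrange).trans (LinearEquiv.ofInjective Λ' h'.injective).symm)
  have hΨ : ∀ x, Λ' (Ψ x) = T (Λ x) := fun x =>
    congrArg Subtype.val ((LinearEquiv.ofInjective Λ' h'.injective).apply_symm_apply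
      (LinearEquiv.ofEq _ _ hrange (LinearEquiv.ofInjective L hL x)))
  refine ⟨AlgEquiv.ofLinearEquiv Ψ ?_ ?_, fun t => ?_⟩
  · apply h'.injective
    rw [hΨ, h.map_one, h'.map_one, hTs, _root_.map_one]
  · intro x y
    apply h'.injective
    rw [hΨ, h.map_mul, h'.map_mul, hΨ, hΨ, _root_.map_mul]
  · have key : ∀ x, x ∈ 𝒜 t ↔ Ψ x ∈ 𝒜' (θ t) := fun x => by
      rw [h𝒜, h𝒜']
      refine exists_congr fun a => ?_
      rw [hΨ, ← hTs, T.injective.eq_iff]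
    ext y
    constructor
    · rintro ⟨x, hx, rfl⟩
      exact (key x).1 hx
    · intro hy
      obtain ⟨x, rfl⟩ := Ψ.surjective y
      exact ⟨x, (key x).2 hy, rfl⟩

end IsCoeffModel

/-! ### The comparison of the two fusion groups -/

namespace GradedInterior

variable {O : Type*} [CommRing O] {G : Type*} [Group G] {H : Subgroup G} [H.Normal]
  {A : Type*} [Ring A] [Algebra O A] (D : GradedInterior O H A) {P : Subgroup G}

@[simp] theorem σ_inv_mul_cancel_left (g : G) (a : A) : D.σ g⁻¹ * (D.σ g * a) = a := by
  rw [← mul_assoc, σ_inv_mul, one_mul]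

/-- The elements `a ∈ i A i` of degree `y` with `φ(u) a = a u` for all `u ∈ P`. -/
def fusionSpace (i : D.fix P) (t : MulAut P × (G ⧸ H)) : Submodule O A where
  carrier := {a | (i : A) * a = a ∧ a * i = a ∧ a ∈ D.comp t.2 ∧
    ∀ u : P, D.σ (t.1 u) * a = a * D.σ u}
  add_mem' := by
    rintro a c ⟨h1, h2, h3, h4⟩ ⟨k1, k2, k3, k4⟩
    exact ⟨by rw [mul_add, h1, k1], by rw [add_mul, h2, k2], add_mem h3 k3,
      fun u => by rw [mul_add, add_mul, h4, k4]⟩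
  zero_mem' := ⟨by simp, by simp, zero_mem _, by simp⟩
  smul_mem' := by
    rintro r a ⟨h1, h2, h3, h4⟩
    exact ⟨by rw [mul_smul_comm, h1], by rw [smul_mul_assoc, h2], Submodule.smul_mem _ r h3,
      fun u => by rw [mul_smul_comm, smul_mul_assoc, h4]⟩

variable {D}

theorem mem_Ai_iff {i : D.fix P} (hi : IsIdempotentElem i) {a : A} :
    a ∈ D.Ai i ↔ a * (i : A) = a := by
  have hi' : (i : A) * i = i := congrArg Subtype.val hi
  rw [Submodule.mem_span_singleton]
  constructor
  · rintro ⟨c, rfl⟩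
    rw [smul_eq_mul, mul_assoc, hi']
  · intro h
    exact ⟨a, h⟩

theorem coe_rightP_of (i : D.fix P) (u : P) (m : D.Ai i) :
    (D.rightP i (MonoidAlgebra.of O P u) m : A) = (m : A) * D.σ u := by
  simp [rightP, σP]

/-- Right multiplication by an element of `A i`. -/
def mulRightAi (i : D.fix P) (d : A) (hd : d ∈ D.Ai i) : D.Ai i →ₗ[A] D.Ai i where
  toFun m := ⟨(m : A) * d, (D.Ai i).smul_mem (m : A) hd⟩
  map_add' m n := Subtype.ext (by simp [add_mul])
  map_smul' r m := Subtype.ext (by simp [mul_assoc])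

theorem mem_Ai_of_mem_fusionSpace {i : D.fix P} {t : MulAut P × (G ⧸ H)} {a : A}
    (ha : a ∈ D.fusionSpace i t) : a ∈ D.Ai i :=
  Submodule.mem_span_singleton.2 ⟨a, ha.2.1⟩

/-- The isomorphisms of graded bimodules `A i ≃ (A i)(y⁻¹)_φ` correspond to the invertible elements
of `i A i` of degree `y` that transform `u` into `φ(u)`. -/
theorem fusionIso_iff {i : D.fix P} (hi : IsIdempotentElem i) (φ : MulAut P) (y : G ⧸ H) :
    D.FusionIso i φ y ↔ ∃ d ∈ D.fusionSpace i (φ⁻¹, y⁻¹), ∃ d' ∈ D.fusionSpace i (φ, y),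
      d * d' = i ∧ d' * d = i := by
  have hi' : (i : A) * i = i := congrArg Subtype.val hi
  have hmi : ∀ m : D.Ai i, (m : A) * i = m := fun m => (mem_Ai_iff hi).1 m.2
  constructor
  · rintro ⟨f, hf, hf'⟩
    let i0 : D.Ai i := ⟨i, (mem_Ai_iff hi).2 hi'⟩
    have hii : (i : A) • i0 = i0 := Subtype.ext hi'
    have hmul : ∀ m : D.Ai i, m = (m : A) • i0 := fun m => Subtype.ext (hmi m).symm
    have hiu : ∀ u : P, D.rightP i (MonoidAlgebra.of O P u) i0 = D.σ u • i0 := fun u =>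
      Subtype.ext (by rw [coe_rightP_of]; exact (i.2.2 u u.2).symm)
    have h0 : i0 ∈ D.AiComp i 1 := i.2.1
    -- An A-linear endomorphism of Ai is right multiplication by the image of i; the images of i
    -- under f and its inverse are the required d and d'.
    have e1 : ∀ m : D.Ai i, (f m : A) = (m : A) * (f i0 : A) := fun m => by
      conv_lhs => rw [hmul m, map_smul]
      rfl
    have e2 : ∀ m : D.Ai i, (f.symm m : A) = (m : A) * (f.symm i0 : A) := fun m => by
      conv_lhs => rw [hmul m, map_smul]
      rfl
    have hu : ∀ u : P, D.σ u * (f i0 : A) = (f i0 : A) * D.σ (φ u) := fun u => by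
      have := congrArg Subtype.val (hf' u i0)
      rw [hiu, map_smul, coe_rightP_of] at this
      exact this
    have hu' : ∀ u : P, D.σ (φ u) * (f.symm i0 : A) = (f.symm i0 : A) * D.σ u := fun u => by
      have h := hf' u (f.symm i0)
      rw [f.apply_symm_apply, hiu, ← LinearEquiv.eq_symm_apply, map_smul] at h
      have := congrArg Subtype.val h
      rw [coe_rightP_of] at this
      exact this.symm
    refine ⟨f i0, ⟨(e1 i0).symm, hmi _, ?_, fun u => ?_⟩, f.symm i0,
      ⟨(e2 i0).symm, hmi _, ?_, hu'⟩, ?_, ?_⟩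
    · have := (hf 1 i0).1 h0
      rw [one_mul] at this
      exact this
    · have := hu (φ⁻¹ u)
      simpa using this
    · have := (hf y (f.symm i0)).2 (by rw [f.apply_symm_apply, mul_inv_cancel]; exact h0)
      exact this
    · rw [← e2, f.symm_apply_apply]
    · rw [← e1, f.apply_symm_apply]
  · rintro ⟨d, hd, d', hd', h1, h2⟩
    refine ⟨LinearEquiv.ofLinearMap (mulRightAi i d (mem_Ai_of_mem_fusionSpace hd))
      (mulRightAi i d' (mem_Ai_of_mem_fusionSpace hd')) ?_ ?_, ?_, ?_⟩
    · ext m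
      change (m : A) * d' * d = m
      rw [mul_assoc, h2, hmi]
    · ext m
      change (m : A) * d * d' = m
      rw [mul_assoc, h1, hmi]
    · intro x m
      change (m : A) ∈ D.comp x ↔ (m : A) * d ∈ D.comp (x * y⁻¹)
      constructor
      · intro h
        exact D.grading.mul_mem h hd.2.2.1
      · intro h
        have := D.grading.mul_mem h hd'.2.2.1
        rwa [mul_assoc (m : A), h1, hmi, inv_mul_cancel_right] at this
    · intro u m
      refine Subtype.ext ?_
      rw [coe_rightP_of]
      change (D.rightP i (MonoidAlgebra.of O P u) m : A) * d = (m : A) * d * D.σ (φ u)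
      rw [coe_rightP_of, mul_assoc, mul_assoc, ← hd.2.2.2 (φ u)]
      simp

/-! ### Conjugation by `N_G(P_γ)` gives fusions of `A i` -/

section Hom

variable (γ : Set (D.fix P))

/-- The action of `N_G(P_γ)` on `P` by conjugation. -/
def normAut : D.normPt γ →* MulAut P where
  toFun g :=
    { toFun := fun u => ⟨g * u * (g : G)⁻¹, (Subgroup.mem_normalizer_iff.1 g.2.1 u).1 u.2⟩
      invFun := fun u => ⟨(g : G)⁻¹ * u * g, by
        have := (Subgroup.mem_normalizer_iff.1 (inv_mem g.2.1) (u : G)).1 u.2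
        rwa [inv_inv] at this⟩
      left_inv := fun u => Subtype.ext (by simp [mul_assoc])
      right_inv := fun u => Subtype.ext (by simp [mul_assoc])
      map_mul' := fun u v => Subtype.ext (by simp [mul_assoc]) }
  map_one' := by
    ext u
    change (1 : G) * u * (1 : G)⁻¹ = u
    simp
  map_mul' g h := by
    ext u
    change ((g * h : D.normPt γ) : G) * u * ((g * h : D.normPt γ) : G)⁻¹ =
      g * (h * u * (h : G)⁻¹) * (g : G)⁻¹
    simp [mul_assoc]

@[simp] theorem coe_normAut (g : D.normPt γ) (u : P) :
    (normAut γ g u : G) = g * u * (g : G)⁻¹ := rfl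

/-- The map `g ↦ (u ↦ g u g⁻¹, g H)` on `N_G(P_γ)`. -/
def normFusion : D.normPt γ →* MulAut P × (G ⧸ H) :=
  (normAut γ).prod ((QuotientGroup.mk' H).comp (D.normPt γ).subtype)

theorem normFusion_ker : (normFusion γ).ker = D.centH γ := by
  ext g
  rw [MonoidHom.mem_ker, centH, Subgroup.mem_subgroupOf, Subgroup.mem_inf,
    Subgroup.mem_centralizer_iff, normFusion, MonoidHom.prod_apply, Prod.mk_eq_one, and_comm]
  refine and_congr (QuotientGroup.eq_one_iff _) ?_
  constructor
  · intro h u hu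
    have := congrArg Subtype.val (DFunLike.congr_fun h (⟨u, hu⟩ : P))
    rw [coe_normAut] at this
    exact (mul_inv_eq_iff_eq_mul.1 this).symm
  · intro h
    ext u
    rw [coe_normAut, MulAut.one_apply, mul_inv_eq_iff_eq_mul]
    exact (h u u.2).symm

/-- The map `g C_H(P) ↦ (u ↦ g u g⁻¹, g H)` on `E`. -/
def gFusionHom : D.gFusion γ →* MulAut P × (G ⧸ H) :=
  QuotientGroup.lift _ (normFusion γ) (normFusion_ker γ).ge

@[simp] theorem gFusionHom_mk (g : D.normPt γ) :
    gFusionHom γ (g : D.gFusion γ) = (normAut γ g, ((g : G) : G ⧸ H)) := rfl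

/-- As g fixes γ, some unit c of B^P carries ᵍi to i. Then cg commutes with i, so i(cg) is
invertible in iAi; it has degree gH and acts on P as g does, because c has degree 1 and centralizes
P. -/
theorem normFusion_mem_aFusion (hγ : IsPoint γ) {i : D.fix P} (hi : i ∈ γ) (g : D.normPt γ) :
    normFusion γ g ∈ D.aFusion i := by
  obtain ⟨e, he, hγe⟩ := hγ
  have hei : IsConj e i := by rwa [hγe] at hi
  have hidem : IsIdempotentElem i := (he.of_isConj hei).idem
  refine ⟨fun u => ?_, (fusionIso_iff hidem _ _).2 ?_⟩
  · change ((g * u * (g : G)⁻¹ : G) : G ⧸ H) = _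
    rfl
  · have hmem : D.conj g i ∈ Subtype.val '' γ := by
      rw [← g.2.2]
      exact ⟨i, ⟨i, hi, rfl⟩, rfl⟩
    obtain ⟨j, hj, hji⟩ := hmem
    have hj : IsConj e j := by rwa [hγe] at hj
    obtain ⟨c, hc⟩ := hj.symm.trans hei
    have hc : (c : D.fix P) * j = i * c := hc
    have hcA : (c : A) * D.conj g i = i * c := by rw [← hji]; exact congrArg Subtype.val hc
    have hcc : ((c : D.fix P) : A) * ((↑c⁻¹ : D.fix P) : A) = 1 :=
      congrArg Subtype.val c.mul_inv
    have hcc' : ((↑c⁻¹ : D.fix P) : A) * ((c : D.fix P) : A) = 1 :=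
      congrArg Subtype.val c.inv_mul
    have hi' : (i : A) * i = i := congrArg Subtype.val hidem
    set a : A := ((c : D.fix P) : A)
    set a' : A := ((↑c⁻¹ : D.fix P) : A)
    have ha : ∀ u : P, D.σ u * a = a * D.σ u := fun u => (c : D.fix P).2.2 u u.2
    have ha' : ∀ u : P, D.σ u * a' = a' * D.σ u := fun u => (↑c⁻¹ : D.fix P).2.2 u u.2
    have hiu : ∀ u : P, D.σ u * (i : A) = i * D.σ u := fun u => i.2.2 u u.2
    set s := D.σ (g : G) with hs
    set s' := D.σ (g : G)⁻¹ with hs'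
    have hss : s * s' = 1 := D.σ_mul_inv g
    have hss' : s' * s = 1 := D.σ_inv_mul g
    have e1 : a * s * (s' * a') = 1 := by rw [mul_assoc, ← mul_assoc s, hss, one_mul, hcc]
    have e2 : s' * a' * (a * s) = 1 := by rw [mul_assoc, ← mul_assoc a', hcc', one_mul, hss']
    have hag : a * s * i = i * (a * s) := by
      rw [← mul_assoc, ← hcA]
      simp only [conj, mul_assoc, ← hs, ← hs', hss', mul_one]
    have hga : s' * a' * i = i * (s' * a') := by
      calc s' * a' * i = s' * a' * (i * (a * s)) * (s' * a') := by
            rw [mul_assoc _ _ (s' * a'), mul_assoc (i : A), e1, mul_one]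
        _ = s' * a' * (a * s) * i * (s' * a') := by rw [← hag]; simp only [mul_assoc]
        _ = _ := by rw [e2, one_mul]
    have hsu : ∀ u : P, D.σ (normAut γ g u : G) * s = s * D.σ u := fun u => by
      rw [hs, ← map_mul, ← map_mul, coe_normAut, inv_mul_cancel_right]
    have hsu' : ∀ u : P, D.σ ((normAut γ g)⁻¹ u : G) * s' = s' * D.σ u := fun u => by
      have := hsu ((normAut γ g)⁻¹ u)
      rw [MulAut.apply_inv_self] at this
      calc _ = s' * s * D.σ ((normAut γ g)⁻¹ u : G) * s' := by rw [hss', one_mul]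
        _ = s' * (s * D.σ ((normAut γ g)⁻¹ u : G)) * s' := by rw [mul_assoc s']
        _ = _ := by rw [← this, mul_assoc, mul_assoc _ s, hss, mul_one]
    refine ⟨s' * a' * i, ⟨?_, ?_, ?_, ?_⟩, i * (a * s), ⟨?_, ?_, ?_, ?_⟩, ?_, ?_⟩
    · rw [hga, ← mul_assoc, hi']
    · rw [mul_assoc, hi']
    · have := D.grading.mul_mem (D.grading.mul_mem (D.σ_mem (g : G)⁻¹) (↑c⁻¹ : D.fix P).2.1) i.2.1
      rw [mul_one, mul_one] at this
      exact this
    · intro u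
      rw [← mul_assoc, ← mul_assoc]
      change D.σ ((normAut γ g)⁻¹ u : G) * s' * a' * i = _
      rw [hsu', mul_assoc _ _ a', ha', ← mul_assoc, mul_assoc, hiu, mul_assoc, mul_assoc, mul_assoc]
    · rw [← mul_assoc, hi']
    · rw [mul_assoc, hag, ← mul_assoc, hi']
    · have := D.grading.mul_mem i.2.1 (D.grading.mul_mem (c : D.fix P).2.1 (D.σ_mem (g : G)))
      rw [one_mul, one_mul] at this
      exact this
    · intro u
      change D.σ (normAut γ g u : G) * _ = _
      rw [← mul_assoc, hiu, mul_assoc, ← mul_assoc _ a, ha, mul_assoc a, hsu]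
      simp only [mul_assoc]
    · rw [mul_assoc, ← mul_assoc (i : A), hi', ← hag, ← mul_assoc, e2, one_mul]
    · rw [hga, ← hag, mul_assoc, ← mul_assoc (i : A) (i : A), hi', ← hga, ← mul_assoc, e1, one_mul]

end Hom

end GradedInterior

/-- Summation over the orbits of a group action. -/
theorem finsum_eq_finsum_orbits {K X A : Type*} [Group K] [MulAction K X] [Finite X]
    [AddCommMonoid A] (F : X → A) :
    ∑ᶠ x, F x = ∑ᶠ ω : MulAction.orbitRel.Quotient K X,
      ∑ᶠ q : K ⧸ MulAction.stabilizer K ω.out, F (q.out • ω.out) := by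
  classical
  let e := MulAction.selfEquivSigmaOrbitsQuotientStabilizer K X
  have := Finite.of_equiv X e
  have := Fintype.ofFinite X
  have : Fintype (MulAction.orbitRel.Quotient K X) := Fintype.ofFinite _
  have hfin : ∀ ω : MulAction.orbitRel.Quotient K X, Finite (K ⧸ MulAction.stabilizer K ω.out) :=
    fun ω => Finite.of_injective (fun q => (⟨ω, q⟩ : Σ ω : MulAction.orbitRel.Quotient K X,
      K ⧸ MulAction.stabilizer K ω.out)) fun _ _ h => by simpa using h
  have := fun ω => @Fintype.ofFinite _ (hfin ω)
  simp only [finsum_eq_sum_of_fintype]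
  rw [← e.symm.sum_comp, Fintype.sum_sigma]
  refine Finset.sum_congr rfl fun ω _ => Finset.sum_congr rfl fun q _ => congrArg F ?_
  have : e.symm ⟨ω, q⟩ = ((MulAction.orbitEquivQuotientStabilizer K ω.out).symm q : X) := rfl
  rw [this]
  conv_lhs => rw [← QuotientGroup.out_eq' q]
  rfl

namespace GradedInterior

variable {O : Type*} [CommRing O] {G : Type*} [Group G] {H : Subgroup G} [H.Normal]
  {A : Type*} [Ring A] [Algebra O A] {D : GradedInterior O H A} {P : Subgroup G}

/-- An element of `N_G(P)` that maps one element of the point `γ` into `γ` stabilizes `γ`. -/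
theorem mem_normPt_of_isConj {γ : Set (D.fix P)} (hγ : IsPoint γ) {i : D.fix P} (hi : i ∈ γ) {g : G}
    (hg : g ∈ Subgroup.normalizer (P : Set G))
    (h : IsConj i ⟨D.conj g i, D.conj_mem_fix P hg i.2⟩) : g ∈ D.normPt γ := by
  have hγi : γ = conjugatesOf i := by
    obtain ⟨e, he, rfl⟩ := hγ
    exact isConj_iff_conjugatesOf_eq.1 hi
  let C : ∀ g : G, g ∈ Subgroup.normalizer (P : Set G) → (D.fix P →* D.fix P) := fun g hg =>
    { toFun := fun a => ⟨D.conj g a, D.conj_mem_fix P hg a.2⟩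
      map_one' := Subtype.ext (by simp [conj, σ_mul_inv])
      map_mul' := fun a c => Subtype.ext (D.conj_mul g a c) }
  have hg' := inv_mem hg
  have hC : C g⁻¹ hg' (C g hg i) = i := Subtype.ext (by
    change D.conj g⁻¹ (D.conj g i) = i
    rw [conj_conj, inv_mul_cancel, conj_one])
  have h' : IsConj i (C g⁻¹ hg' i) := by
    have := (C g⁻¹ hg').map_isConj h
    change IsConj _ (C g⁻¹ hg' (C g hg i)) at this
    rw [hC] at this
    exact this.symm
  refine ⟨hg, Set.Subset.antisymm ?_ ?_⟩
  · rintro _ ⟨_, ⟨c, hc, rfl⟩, rfl⟩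
    refine ⟨C g hg c, ?_, rfl⟩
    rw [hγi] at hc ⊢
    exact h.trans ((C g hg).map_isConj hc)
  · rintro _ ⟨c, hc, rfl⟩
    refine ⟨C g⁻¹ hg' c, ⟨_, ?_, rfl⟩, ?_⟩
    · rw [hγi] at hc ⊢
      exact h'.trans ((C g⁻¹ hg').map_isConj hc)
    · change D.conj g (D.conj g⁻¹ c) = c
      rw [conj_conj, mul_inv_cancel, conj_one]

/-- Stabilizers are subgroups of P, while `relTrace` takes a subgroup of G; this passes from one
form to the other. -/
theorem relTrace_eq (D : GradedInterior O H A) {Q : Subgroup G} {K : Subgroup P}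
    (h : Q.subgroupOf P = K) (a : A) :
    D.relTrace P Q a = ∑ᶠ x : P ⧸ K, D.conj (x.out : P) a := by
  subst h
  rfl

/-! ### The Brauer kernel is stable under multiplication by `B^P` -/

section Brauer

theorem conj_of_mem_fix {s : A} (hs : s ∈ D.fix P) {u : G} (hu : u ∈ P) : D.conj u s = s := by
  rw [conj, hs.2 u hu, mul_assoc, σ_mul_inv, mul_one]

variable [Finite G]

theorem mul_relTrace {s : A} (hs : s ∈ D.fix P) (Q : Subgroup G) (a : A) :
    s * D.relTrace P Q a = D.relTrace P Q (s * a) := by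
  rw [relTrace, relTrace, mul_finsum' _ _ (Set.toFinite _)]
  refine finsum_congr fun x => ?_
  rw [conj_mul, conj_of_mem_fix hs x.out.2]

theorem relTrace_mul {s : A} (hs : s ∈ D.fix P) (Q : Subgroup G) (a : A) :
    D.relTrace P Q a * s = D.relTrace P Q (a * s) := by
  rw [relTrace, relTrace, finsum_mul' _ _ (Set.toFinite _)]
  refine finsum_congr fun x => ?_
  rw [conj_mul, conj_of_mem_fix hs x.out.2]

variable [IsLocalRing O]

/-- P-fixed factors can be moved inside relative traces. With its right-hand analogue, this makes
membership of an idempotent in the kernel depend only on its conjugacy class in B^P. -/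
theorem mul_mem_brauerKer_left {s t : A} (hs : s ∈ D.fix P) (ht : t ∈ D.brauerKer P) :
    s * t ∈ D.brauerKer P := by
  suffices h : D.brauerKer P ≤ (D.brauerKer P).comap (LinearMap.mulLeft O s) from h ht
  refine sup_le (Submodule.span_le.2 ?_) (Submodule.smul_le.2 fun r hr n hn => ?_)
  · rintro _ ⟨Q, hQ, a, ha, rfl⟩
    refine Submodule.mem_sup_left (Submodule.subset_span ⟨Q, hQ, s * a, (D.fix Q).mul_mem ?_ ha, ?_⟩)
    · exact ⟨hs.1, fun u hu => hs.2 u (hQ.le hu)⟩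
    · exact mul_relTrace hs Q a
  · change s * (r • n) ∈ D.brauerKer P
    rw [mul_smul_comm]
    exact Submodule.mem_sup_right (Submodule.smul_mem_smul hr ((D.fix P).mul_mem hs hn))

theorem mul_mem_brauerKer_right {s t : A} (hs : s ∈ D.fix P) (ht : t ∈ D.brauerKer P) :
    t * s ∈ D.brauerKer P := by
  suffices h : D.brauerKer P ≤ (D.brauerKer P).comap (LinearMap.mulRight O s) from h ht
  refine sup_le (Submodule.span_le.2 ?_) (Submodule.smul_le.2 fun r hr n hn => ?_)
  · rintro _ ⟨Q, hQ, a, ha, rfl⟩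
    refine Submodule.mem_sup_left (Submodule.subset_span ⟨Q, hQ, a * s, (D.fix Q).mul_mem ha ?_, ?_⟩)
    · exact ⟨hs.1, fun u hu => hs.2 u (hQ.le hu)⟩
    · exact relTrace_mul hs Q a
  · change (r • n) * s ∈ D.brauerKer P
    rw [smul_mul_assoc]
    exact Submodule.mem_sup_right (Submodule.smul_mem_smul hr ((D.fix P).mul_mem hn hs))

/-- No element of a local point lies in the kernel of the Brauer homomorphism. -/
theorem IsLocalPoint.notMem_brauerKer {γ : Set (D.fix P)} (hγ : D.IsLocalPoint P γ) {i : D.fix P}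
    (hi : i ∈ γ) : (i : A) ∉ D.brauerKer P := by
  obtain ⟨⟨e, he, rfl⟩, j, hj, hjk⟩ := hγ
  intro h
  have hi : IsConj e i := hi
  have hj : IsConj e j := hj
  obtain ⟨c, hc⟩ := hi.symm.trans hj
  have hc : (c : D.fix P) * i = j * c := hc
  have hji : j = c * i * ↑c⁻¹ := by rw [hc]; simp
  apply hjk
  rw [hji]
  exact mul_mem_brauerKer_right (↑c⁻¹ : D.fix P).2 (mul_mem_brauerKer_left (c : D.fix P).2 h)

end Brauer

/-- The set `G` with the action `u • g = u g φ(u)⁻¹` of `P`. -/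
def TwistedSet (_ : MulAut P) : Type _ := G

instance (φ : MulAut P) : MulAction P (TwistedSet φ) where
  smul u g := ((u : G) * (show G from g) * (φ u : G)⁻¹ : G)
  one_smul := by
    refine fun g : G => (?_ : ((1 : P) : G) * g * (φ 1 : G)⁻¹ = g)
    simp
  mul_smul u v := by
    refine fun g : G => (?_ : ((u * v : P) : G) * g * (φ (u * v) : G)⁻¹ =
      (u : G) * ((v : G) * g * (φ v : G)⁻¹) * (φ u : G)⁻¹)
    simp [mul_assoc]

instance [Finite G] (φ : MulAut P) : Finite (TwistedSet φ) := inferInstanceAs (Finite G)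

end GradedInterior

/-! ### For block extensions, every fusion of `A i` comes from an element of `G` -/

namespace InvariantBlock

open GradedInterior

variable {O : Type*} [CommRing O] {G : Type*} [Group G] {H : Subgroup G} [H.Normal]
  (β : InvariantBlock O H) {P : Subgroup G}

theorem coe_ext_σ_mul (g : G) (a : β.Alg) :
    (β.ext.σ g * a).1 = MonoidAlgebra.of O G g * a.1 := by
  change β.bG * MonoidAlgebra.of O G g * a.1 = _
  rw [← of_mul_bG, mul_assoc, bG_mul]

theorem coe_mul_ext_σ (g : G) (a : β.Alg) :
    (a * β.ext.σ g).1 = a.1 * MonoidAlgebra.of O G g := by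
  change a.1 * (β.bG * MonoidAlgebra.of O G g) = _
  rw [← mul_assoc, mul_bG]

theorem eq_sum_coeff [Fintype G] (a : β.Alg) : a = ∑ g : G, a.1.coeff g • β.ext.σ g := by
  have h : β.proj a.1 = a := Subtype.ext (β.bG_mul a)
  conv_lhs => rw [← h, ← MonoidAlgebra.sum_coeff_single a.1]
  rw [Finsupp.sum_fintype _ _ (by simp), map_sum]
  refine Finset.sum_congr rfl fun g _ => ?_
  rw [← mul_one (a.1.coeff g), ← smul_eq_mul, ← MonoidAlgebra.smul_single, map_smul, smul_eq_mul,
    mul_one]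
  rfl

theorem finite_alg [Finite G] : Module.Finite O β.Alg := by
  have h : Function.Surjective β.proj := fun a => ⟨a.1, Subtype.ext (β.bG_mul a)⟩
  have : Module.Finite O (MonoidAlgebra O G) := inferInstance
  exact Module.Finite.of_surjective β.proj h

variable [Finite G]

/-- An element of `OGb` that transforms `u` into `φ(u)` and has an inverse not in the kernel of the
Brauer homomorphism has an element of `G` with this property in its support. -/
theorem exists_mem_support [IsLocalRing O] {i : β.ext.fix P} (hi : (i : β.Alg) ∉ β.ext.brauerKer P)
    {φ : MulAut P} {y : G ⧸ H} {d d' : β.Alg} (hd : d ∈ β.ext.fusionSpace i (φ⁻¹, y⁻¹))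
    (hd' : d' ∈ β.ext.fusionSpace i (φ, y)) (hdd : d * d' = i) :
    ∃ g : G, (∀ u : P, (u : G) * g = g * φ u) ∧ (g : G ⧸ H) = y⁻¹ := by
  classical
  have hft := Fintype.ofFinite G
  by_contra! hne
  apply hi
  -- From ud = dφ(u): the coefficients of d are constant on the orbits of the twisted action.
  have hinv : ∀ (u : P) (g : G), d.1.coeff (u * g * (φ u : G)⁻¹) = d.1.coeff g := by
    intro u g
    have h := congrArg Subtype.val (hd.2.2.2 (φ u))
    rw [coe_ext_σ_mul, coe_mul_ext_σ] at h
    simp only [MulAut.inv_apply_self] at h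
    have := congrArg (fun z => z.coeff ((u : G) * g)) h
    simpa [MonoidAlgebra.of_apply] using this.symm
  -- Moving g along its twisted orbit by u conjugates gd' by u, so the terms of dd' over an orbit
  -- are P-conjugates of one another.
  have hσ : ∀ (u : P) (g : G), β.ext.σ (u * g * (φ u : G)⁻¹) * d' =
      β.ext.conj u (β.ext.σ g * d') := by
    intro u g
    have h := hd'.2.2.2 u
    have h2 : β.ext.σ (φ u : G)⁻¹ * d' = d' * β.ext.σ (u : G)⁻¹ := by
      calc _ = β.ext.σ (φ u : G)⁻¹ * (d' * β.ext.σ u) * β.ext.σ (u : G)⁻¹ := by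
            rw [mul_assoc, mul_assoc, σ_mul_inv, mul_one]
        _ = _ := by rw [← h, σ_inv_mul_cancel_left]
    rw [map_mul, map_mul, mul_assoc, h2]
    simp only [conj, mul_assoc]
  let F : TwistedSet φ → β.Alg := fun g => d.1.coeff (show G from g) • (β.ext.σ (show G from g) * d')
  have hsum : (i : β.Alg) = ∑ᶠ g : TwistedSet φ, F g := by
    change _ = ∑ᶠ g : G, d.1.coeff g • (β.ext.σ g * d')
    rw [finsum_eq_sum_of_fintype, ← hdd]
    conv_lhs => rw [β.eq_sum_coeff d, Finset.sum_mul]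
    simp only [smul_mul_assoc]
  rw [hsum, finsum_eq_finsum_orbits (K := P)]
  refine finsum_induction (· ∈ β.ext.brauerKer P) (zero_mem _) (fun _ _ => add_mem) fun ω => ?_
  let g : G := ω.out
  have hF : ∀ u : P, F (u • ω.out) = d.1.coeff g • β.ext.conj u (β.ext.σ g * d') := by
    intro u
    change d.1.coeff (u * g * (φ u : G)⁻¹) • (β.ext.σ (u * g * (φ u : G)⁻¹) * d') = _
    rw [hinv, hσ]
  simp only [hF]
  by_cases hg : d.1.coeff g = 0
  · simp [hg, zero_mem]
  have hgy : (g : G ⧸ H) = y⁻¹ := hd.2.2.1 g hg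
  set K := MulAction.stabilizer P ω.out with hK
  have hmemK : ∀ u : P, u ∈ K ↔ (u : G) * g = g * φ u := fun u => by
    rw [hK, MulAction.mem_stabilizer_iff]
    change (u : G) * g * (φ u : G)⁻¹ = g ↔ _
    rw [mul_inv_eq_iff_eq_mul]
  have hQK : (K.map P.subtype).subgroupOf P = K :=
    Subgroup.comap_map_eq_self_of_injective P.subtype_injective K
  -- The sum over the orbit of g is the coefficient of g times the relative trace of gd' from the
  -- stabilizer. That stabilizer is proper, since otherwise g would be an element of the kind
  -- excluded by `hne`.
  rw [← smul_finsum' _ (Set.toFinite _)]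
  refine Submodule.smul_mem _ _ (Submodule.mem_sup_left (Submodule.subset_span
    ⟨K.map P.subtype, ?_, β.ext.σ g * d', ⟨?_, ?_⟩, ?_⟩))
  · refine lt_of_le_of_ne (Subgroup.map_subtype_le K) fun h => hne g (fun u => ?_) hgy
    have : (u : G) ∈ K.map P.subtype := by rw [h]; exact u.2
    obtain ⟨v, hv, hvu⟩ := this
    rw [← Subtype.ext hvu]
    exact (hmemK v).1 hv
  · have := β.ext.grading.mul_mem (β.ext.σ_mem g) hd'.2.2.1
    rwa [hgy, inv_mul_cancel] at this
  · rintro _ ⟨u, hu, rfl⟩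
    have h := (hmemK u).1 hu
    change β.ext.σ (u : G) * _ = _ * β.ext.σ (u : G)
    rw [← mul_assoc, ← map_mul, h, map_mul, mul_assoc, hd'.2.2.2 u, mul_assoc]
  · rw [relTrace_eq β.ext hQK]

variable [IsLocalRing O] [IsNoetherianRing O] [IsAdicComplete (IsLocalRing.maximalIdeal O) O]

/-- Every fusion in `F` is induced by conjugation with an element of `N_G(P_γ)`. -/
theorem exists_normFusion_eq {γ : Set (β.ext.fix P)} (hγ : β.ext.IsLocalPoint P γ)
    {i : β.ext.fix P} (hi : i ∈ γ) {t : MulAut P × (G ⧸ H)} (ht : t ∈ β.ext.aFusion i) :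
    ∃ g : β.ext.normPt γ, normFusion γ g = t := by
  obtain ⟨φ, y⟩ := t
  have hprim : IsPrimitiveIdem i := by
    obtain ⟨⟨e, he, rfl⟩, -⟩ := hγ
    exact he.of_isConj hi
  obtain ⟨d, hd, d', hd', h1, h2⟩ := (fusionIso_iff hprim.idem φ y).1 ht.2
  obtain ⟨g, hg, hgy⟩ := β.exists_mem_support (hγ.notMem_brauerKer hi) hd hd' h1
  have hφ : ∀ u : P, g⁻¹ * u * g = φ u := fun u => by rw [mul_assoc, hg, inv_mul_cancel_left]
  have hgN : g⁻¹ ∈ Subgroup.normalizer (P : Set G) := by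
    refine Subgroup.mem_normalizer_iff.2 fun u => ⟨fun hu => ?_, fun hu => ?_⟩
    · rw [inv_inv, hφ ⟨u, hu⟩]
      exact (φ ⟨u, hu⟩).2
    · rw [inv_inv] at hu
      have := hφ (φ⁻¹ ⟨_, hu⟩)
      rw [MulAut.apply_inv_self] at this
      rw [← mul_left_cancel (mul_right_cancel this)]
      exact (φ⁻¹ ⟨_, hu⟩).2
  have hgN' : g ∈ Subgroup.normalizer (P : Set G) := inv_inv g ▸ inv_mem hgN
  have hdu : ∀ u : P, β.ext.σ u * d = d * β.ext.σ (φ u) := fun u => by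
    have := hd.2.2.2 (φ u)
    simpa using this
  -- In dg⁻¹ and gd' the degrees cancel and so do the twists by φ, so both lie in B^P; they make i
  -- and ᵍi associated there.
  let x : β.ext.fix P := ⟨d * β.ext.σ g⁻¹, by
    have := β.ext.grading.mul_mem hd.2.2.1 (β.ext.σ_mem g⁻¹)
    rwa [QuotientGroup.mk_inv, hgy, inv_inv, inv_mul_cancel] at this, fun u hu => by
    rw [← mul_assoc, hdu ⟨u, hu⟩, mul_assoc, mul_assoc, ← map_mul, ← map_mul, ← hφ ⟨u, hu⟩,
      mul_inv_cancel_right]⟩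
  let x' : β.ext.fix P := ⟨β.ext.σ g * d', by
    have := β.ext.grading.mul_mem (β.ext.σ_mem g) hd'.2.2.1
    rwa [hgy, inv_mul_cancel] at this, fun u hu => by
    rw [← mul_assoc, ← map_mul, hg ⟨u, hu⟩, map_mul, mul_assoc, hd'.2.2.2 ⟨u, hu⟩, mul_assoc]⟩
  have hfin : Module.Finite O (β.ext.fix P) :=
    have := β.finite_alg
    have := isNoetherian_of_isNoetherianRing_of_finite O β.Alg
    Module.IsNoetherian.finite O (Subalgebra.toSubmodule (β.ext.fix P))
  have hconj : IsConj i ⟨β.ext.conj g i, β.ext.conj_mem_fix P hgN' i.2⟩ := by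
    refine hprim.isConj_of_assoc (O := O) (x := x) (y := x') ?_ ?_ ?_ ?_ ?_ ?_ <;>
      refine Subtype.ext ?_
    · change (i : β.Alg) * (d * _) = d * _
      rw [← mul_assoc, hd.1]
    · change d * β.ext.σ g⁻¹ * (β.ext.σ g * i * β.ext.σ g⁻¹) = d * β.ext.σ g⁻¹
      rw [mul_assoc, mul_assoc (β.ext.σ g), σ_inv_mul_cancel_left, ← mul_assoc, hd.2.1]
    · change β.ext.σ g * i * β.ext.σ g⁻¹ * (β.ext.σ g * d') = β.ext.σ g * d'
      rw [mul_assoc, σ_inv_mul_cancel_left, mul_assoc, hd'.1]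
    · change β.ext.σ g * d' * i = β.ext.σ g * d'
      rw [mul_assoc, hd'.2.1]
    · change d * β.ext.σ g⁻¹ * (β.ext.σ g * d') = i
      rw [mul_assoc, σ_inv_mul_cancel_left, h1]
    · change β.ext.σ g * d' * (d * β.ext.σ g⁻¹) = β.ext.σ g * i * β.ext.σ g⁻¹
      rw [← h2]
      simp only [mul_assoc]
  -- The inverse appears because ug = gφ(u) means that conjugation by g⁻¹ induces φ.
  refine ⟨⟨g⁻¹, inv_mem (mem_normPt_of_isConj hγ.1 hi hgN' hconj)⟩, Prod.ext ?_ ?_⟩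
  · ext u
    change g⁻¹ * u * g⁻¹⁻¹ = φ u
    rw [inv_inv, hφ]
  · change ((g⁻¹ : G) : G ⧸ H) = y
    rw [QuotientGroup.mk_inv, hgy, inv_inv]

/-- The isomorphism `g C_H(P) ↦ (u ↦ g u g⁻¹, g H)` of the fusion groups. -/
def fusionEquiv {γ : Set (β.ext.fix P)} (hγ : β.ext.IsLocalPoint P γ) {i : β.ext.fix P}
    (hi : i ∈ γ) : β.ext.gFusion γ ≃* β.ext.aFusion i :=
  QuotientGroup.liftEquiv (N := β.ext.centH γ)
    (φ := (normFusion γ).codRestrict (β.ext.aFusion i) (normFusion_mem_aFusion γ hγ.1 hi))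
    (fun t => by
      obtain ⟨g, hg⟩ := β.exists_normFusion_eq hγ hi t.2
      exact ⟨g, Subtype.ext hg⟩)
    (by rw [MonoidHom.ker_codRestrict, normFusion_ker])

theorem coe_fusionEquiv {γ : Set (β.ext.fix P)} (hγ : β.ext.IsLocalPoint P γ) {i : β.ext.fix P}
    (hi : i ∈ γ) (e : β.ext.gFusion γ) : (β.fusionEquiv hγ hi e).1 = gFusionHom γ e := by
  induction e using QuotientGroup.induction_on with
  | H g => rfl

end InvariantBlock

/-! ### Tensor products and crossed products -/

namespace BalTensor

variable {O S M N L : Type*} [CommRing O] [AddCommGroup M] [Module O M] [AddCommGroup N]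
  [Module O N] [AddCommGroup L] [Module O L] (ρ : S → M →ₗ[O] M) (l : S → N →ₗ[O] N)

/-- The bilinear map `(m, n) ↦ m ⊗ n`. -/
def mk : M →ₗ[O] N →ₗ[O] BalTensor ρ l := (TensorProduct.mk O M N).compr₂ (balRel ρ l).mkQ

theorem tmul_balanced (s : S) (m : M) (n : N) : tmul ρ l (ρ s m) n = tmul ρ l m (l s n) := by
  rw [tmul, tmul, ← sub_eq_zero, ← map_sub, Submodule.mkQ_apply, Submodule.Quotient.mk_eq_zero]
  exact Submodule.subset_span ⟨s, m, n, rfl⟩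

variable {ρ l}

/-- The linear map on `M ⊗_S N` given by a balanced bilinear map. -/
def lift (b : M →ₗ[O] N →ₗ[O] L) (hb : ∀ s m n, b (ρ s m) n = b m (l s n)) :
    BalTensor ρ l →ₗ[O] L :=
  (balRel ρ l).liftQ (TensorProduct.lift b) (by
    rw [balRel, Submodule.span_le]
    rintro _ ⟨s, m, n, rfl⟩
    simp [hb])

@[elab_as_elim]
theorem induction_on {p : BalTensor ρ l → Prop} (t : BalTensor ρ l)
    (tmul : ∀ m n, p (tmul ρ l m n)) (add : ∀ x y, p x → p y → p (x + y)) : p t := by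
  obtain ⟨t, rfl⟩ := (balRel ρ l).mkQ_surjective t
  induction t using TensorProduct.induction_on with
  | zero =>
    have := tmul 0 0
    rwa [BalTensor.tmul, TensorProduct.zero_tmul] at this
  | tmul m n => exact tmul m n
  | add x y hx hy => rw [map_add]; exact add _ _ hx hy

end BalTensor

namespace CrossedProduct

variable {O N S : Type*} [CommRing O] [Group N] [Ring S] [Algebra O S]
  [MulSemiringAction N S] [SMulCommClass N O S] (K : Subgroup N) (ι : K →* S)

theorem elt_mul_elt (s t : S) (g h : N) :
    elt O K ι s g * elt O K ι t h = elt O K ι (s * g • t) (g * h) := by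
  rw [elt, elt, elt, ← map_mul, SkewMonoidAlgebra.single_mul_single]

theorem elt_one_one : elt O K ι 1 1 = 1 := by
  rw [elt, SkewMonoidAlgebra.single_one_one, map_one]

/-- The linear map `s ↦ s ⊗ g`. -/
def eltₗ (g : N) : S →ₗ[O] CrossedProduct K ι where
  toFun s := elt O K ι s g
  map_add' s t := by rw [elt, elt, elt, ← map_add, SkewMonoidAlgebra.single_add]
  map_smul' r s := by
    rw [elt, elt, RingHom.id_apply, ← map_smul, SkewMonoidAlgebra.smul_single]

theorem eltₗ_apply (g : N) (s : S) : eltₗ (O := O) K ι g s = elt O K ι s g := rfl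

theorem elt_coe (z : K) : elt O K ι 1 (z : N) = elt O K ι (ι z) 1 :=
  (RingQuot.mkAlgHom_rel O ⟨z, rfl, rfl⟩).symm

theorem elt_coe_mul (s : S) (z : K) (g : N) : elt O K ι s (z * g) = elt O K ι (s * ι z) g := by
  have h1 : elt O K ι s 1 * elt O K ι 1 (z : N) * elt O K ι 1 g = elt O K ι s (z * g) := by
    simp [elt_mul_elt]
  rw [← h1, elt_coe]
  simp [elt_mul_elt]

@[elab_as_elim]
theorem induction_on {p : CrossedProduct K ι → Prop} (x : CrossedProduct K ι)
    (elt : ∀ s g, p (elt O K ι s g)) (add : ∀ x y, p x → p y → p (x + y)) : p x := by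
  obtain ⟨x, rfl⟩ := RingQuot.mkAlgHom_surjective O (crossedRel K ι) x
  induction x using SkewMonoidAlgebra.induction_on' with
  | single g s => exact elt s g
  | add x y hx hy => rw [map_add]; exact add _ _ hx hy

theorem elt_mem_comp (s : S) (g : N) : elt O K ι s g ∈ comp O K ι (g : N ⧸ K) :=
  Submodule.subset_span ⟨s, g, rfl, rfl⟩

theorem mul_mem_comp [K.Normal] {x y : N ⧸ K} {r t : CrossedProduct K ι} (hr : r ∈ comp O K ι x)
    (ht : t ∈ comp O K ι y) : r * t ∈ comp O K ι (x * y) := by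
  refine Submodule.span_induction ?_ (by simp) (fun a c _ _ ha hc => ?_) (fun k a _ ha => ?_) hr
  · rintro _ ⟨s, g, rfl, rfl⟩
    refine Submodule.span_induction ?_ (by simp) (fun a c _ _ ha hc => ?_) (fun k a _ ha => ?_) ht
    · rintro _ ⟨s', g', rfl, rfl⟩
      rw [elt_mul_elt, ← QuotientGroup.mk_mul]
      exact elt_mem_comp K ι _ _
    · rw [mul_add]; exact add_mem ha hc
    · rw [mul_smul_comm]; exact Submodule.smul_mem _ _ ha
  · rw [add_mul]; exact add_mem ha hc
  · rw [smul_mul_assoc]; exact Submodule.smul_mem _ _ ha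

/-- The elements of the crossed product are the sums of elements `s ⊗ g`, with `g` in a system of
representatives. -/
theorem exists_eq_sum [K.Normal] (x : CrossedProduct K ι) :
    ∃ c : (N ⧸ K) →₀ S, x = c.sum fun e s => elt O K ι s e.out := by
  refine CrossedProduct.induction_on (O := O) K ι x (fun s g => ?_) ?_
  · have hz : g * (g : N ⧸ K).out⁻¹ ∈ K := by
      rw [← QuotientGroup.eq_one_iff, QuotientGroup.mk_mul, QuotientGroup.mk_inv,
        QuotientGroup.out_eq', mul_inv_cancel]
    refine ⟨Finsupp.single (g : N ⧸ K) (s * ι ⟨_, hz⟩), ?_⟩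
    rw [Finsupp.sum_single_index, ← elt_coe_mul]
    · simp
    · exact map_zero (eltₗ (O := O) K ι _)
  · rintro _ _ ⟨c, rfl⟩ ⟨d, rfl⟩
    refine ⟨c + d, ?_⟩
    rw [Finsupp.sum_add_index']
    · exact fun e => map_zero (eltₗ (O := O) K ι _)
    · exact fun e => map_add (eltₗ (O := O) K ι _)

end CrossedProduct

/-! ### The algebra of endomorphisms of the module induced to the crossed product -/

namespace GradedInterior

variable {O : Type*} [CommRing O] {G : Type*} [Group G] {H : Subgroup G} [H.Normal]
  {A : Type*} [Ring A] [Algebra O A] {D : GradedInterior O H A} {P : Subgroup G}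
  (γ : Set (D.fix P))

/-- The embedding `s ⊗ g ↦ s g` of `B^P * E` into the group algebra of `E` over `A`. -/
def bpeEmb : D.BPE γ →ₐ[O] MonoidAlgebra A (D.gFusion γ) :=
  RingQuot.liftAlgHom O ⟨SkewMonoidAlgebra.liftNCAlgHom
    (MonoidAlgebra.singleOneAlgHom.comp (D.fix P).val)
    { toFun := fun g => MonoidAlgebra.single (g : D.gFusion γ) (D.σ (g : G))
      map_one' := by simp [MonoidAlgebra.one_def]
      map_mul' := fun g h => by simp [MonoidAlgebra.single_mul_single] }
    (by
      intro s g
      simp [MonoidAlgebra.single_mul_single, coe_smul_fix, conj, mul_assoc, σ_inv_mul]), by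
    rintro _ _ ⟨z, rfl, rfl⟩
    have hz : ((z : D.normPt γ) : D.gFusion γ) = 1 := (QuotientGroup.eq_one_iff _).2 z.2
    simp [SkewMonoidAlgebra.liftNCAlgHom, SkewMonoidAlgebra.liftNCRingHom, 
      MonoidAlgebra.single_mul_single, hz, intHom]⟩

theorem bpeEmb_elt (s : D.fix P) (g : D.normPt γ) :
    bpeEmb γ (CrossedProduct.elt O (D.centH γ) (D.intHom γ) s g) =
      MonoidAlgebra.single (g : D.gFusion γ) ((s : A) * D.σ (g : G)) := by
  rw [CrossedProduct.elt, bpeEmb, RingQuot.liftAlgHom_mkAlgHom_apply]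
  simp [SkewMonoidAlgebra.liftNCAlgHom, SkewMonoidAlgebra.liftNCRingHom, 
      MonoidAlgebra.single_mul_single]

/-- In the normal form over coset representatives, the coefficient at e is an element of B^P times
the invertible σ(e.out), so it determines that element. This also shows that the normal form is
unique. -/
theorem bpeEmb_injective : Function.Injective (bpeEmb γ) := by
  rw [injective_iff_map_eq_zero]
  classical
  intro x hx
  obtain ⟨c, rfl⟩ := CrossedProduct.exists_eq_sum (O := O) _ _ x
  have hc : ∀ e, c e = 0 := fun e => by
    have h := congrArg (fun z => z.coeff e) hx
    have hout : ∀ e : D.gFusion γ, ((e.out : D.normPt γ) : D.gFusion γ) = e :=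
      QuotientGroup.out_eq'
    simp only [Finsupp.sum, map_sum, bpeEmb_elt, hout, MonoidAlgebra.coeff_sum,
      MonoidAlgebra.coeff_single, Finsupp.finsetSum_apply, Finsupp.single_apply,
      Finset.sum_ite_eq', MonoidAlgebra.coeff_zero, Finsupp.zero_apply] at h
    by_contra hne
    rw [if_pos (Finsupp.mem_support_iff.2 hne)] at h
    apply hne
    apply Subtype.ext
    calc (c e : A) = c e * D.σ (e.out : G) * D.σ (e.out : G)⁻¹ := by
          rw [mul_assoc, σ_mul_inv, mul_one]
      _ = 0 := by rw [h, zero_mul]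
  have : c = 0 := Finsupp.ext hc
  rw [this, Finsupp.sum_zero_index]

/-- For s ∈ B^P, moving gug⁻¹ past s and then past g turns it into u; hence coefficients of B^P * E
satisfy all conditions of `fusionSpace` except those involving i. -/
theorem bpeEmb_coeff_mem (x : D.BPE γ) (e : D.gFusion γ) :
    (bpeEmb γ x).coeff e ∈ D.comp (gFusionHom γ e).2 ∧
    ∀ u : P, D.σ ((gFusionHom γ e).1 u) * (bpeEmb γ x).coeff e =
      (bpeEmb γ x).coeff e * D.σ u := by
  classical
  refine CrossedProduct.induction_on (O := O) _ _ x (fun s g => ?_) ?_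
  · rw [bpeEmb_elt, MonoidAlgebra.coeff_single]
    by_cases h : (g : D.gFusion γ) = e
    · subst h
      rw [Finsupp.single_eq_same, gFusionHom_mk]
      refine ⟨by simpa using D.grading.mul_mem s.2.1 (D.σ_mem (g : G)), fun u => ?_⟩
      have := s.2.2 (normAut γ g u) (normAut γ g u).2
      rw [← mul_assoc, this, mul_assoc, mul_assoc, ← map_mul, ← map_mul, coe_normAut,
        inv_mul_cancel_right]
    · rw [Finsupp.single_eq_of_ne (Ne.symm h)]
      simp [zero_mem]
  · rintro x y ⟨h1, h2⟩ ⟨k1, k2⟩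
    rw [map_add, MonoidAlgebra.coeff_add, Finsupp.add_apply]
    exact ⟨add_mem h1 k1, fun u => by rw [mul_add, add_mul, h2, k2]⟩

theorem bpeEmb_mem_comp {x : D.BPE γ} {e : D.gFusion γ}
    (hx : x ∈ CrossedProduct.comp O (D.centH γ) (D.intHom γ) e) :
    ∃ a, bpeEmb γ x = MonoidAlgebra.single e a := by
  refine Submodule.span_induction ?_ ⟨0, by simp⟩ ?_ ?_ hx
  · rintro _ ⟨s, g, rfl, rfl⟩
    exact ⟨_, bpeEmb_elt γ s g⟩
  · rintro x y _ _ ⟨a, ha⟩ ⟨c, hc⟩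
    exact ⟨a + c, by rw [map_add, ha, hc, MonoidAlgebra.single_add]⟩
  · rintro r x _ ⟨a, ha⟩
    exact ⟨r • a, by rw [map_smul, ha, MonoidAlgebra.smul_single]⟩

variable (i : D.fix P)

/-- The map `r ⊗ m ↦ r m` from the induced module to `B^P * E`. -/
def indEMul : D.indE γ i →ₗ[O] D.BPE γ :=
  BalTensor.lift ((LinearMap.mul O (D.BPE γ)).compl₂
    (CrossedProduct.eltₗ (D.centH γ) (D.intHom γ) 1 ∘ₗ (D.BPi i).subtype.restrictScalars O)) (by
    intro s r m
    simp only [rightBP, leftBP, LinearMap.compl₂_apply, LinearMap.mul_apply', LinearMap.comp_apply,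
      CrossedProduct.eltₗ_apply, LinearMap.mulRight_apply, mul_assoc, CrossedProduct.elt_mul_elt]
    simp)

theorem indEMul_tmul (r : D.BPE γ) (m : D.BPi i) :
    indEMul γ i (BalTensor.tmul _ _ r m) =
      r * CrossedProduct.elt O (D.centH γ) (D.intHom γ) (m : D.fix P) 1 := rfl

/-- The map `r ↦ r ⊗ i` from `B^P * E` to the induced module. -/
def indEGen : D.BPE γ →ₗ[O] D.indE γ i :=
  (BalTensor.mk (D.rightBP γ) (D.leftBP i)).flip ⟨i, Submodule.mem_span_singleton_self i⟩

theorem actE_indEGen (r s : D.BPE γ) :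
    D.actE γ i r (indEGen γ i s) = indEGen γ i (r * s) := rfl

theorem indEMul_actE (r : D.BPE γ) (n : D.indE γ i) :
    indEMul γ i (D.actE γ i r n) = r * indEMul γ i n := by
  refine BalTensor.induction_on n (fun s m => ?_) fun x y hx hy => ?_
  · change indEMul γ i (BalTensor.tmul _ _ (r * s) m) = _
    rw [indEMul_tmul, indEMul_tmul, mul_assoc]
  · rw [map_add, map_add, map_add, hx, hy, mul_add]

variable {i}

theorem mul_eq_of_mem_BPi (hi : IsIdempotentElem i) (m : D.BPi i) : (m : D.fix P) * i = m := by
  obtain ⟨m, hm⟩ := m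
  obtain ⟨a, rfl⟩ := Submodule.mem_span_singleton.1 hm
  change a * i * i = a * i
  rw [mul_assoc, hi.eq]

/-- Since m = mi, one has r ⊗ m = rm ⊗ i. Thus the induced module is identified with the left ideal
(B^P * E)i. -/
theorem indEGen_indEMul (hi : IsIdempotentElem i) (n : D.indE γ i) :
    indEGen γ i (indEMul γ i n) = n := by
  refine BalTensor.induction_on n (fun r m => ?_) fun x y hx hy => ?_
  · rw [indEMul_tmul]
    change BalTensor.tmul _ _ (D.rightBP γ (m : D.fix P) r) _ = _
    rw [BalTensor.tmul_balanced]
    congr 1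
    exact Subtype.ext (mul_eq_of_mem_BPi hi m)
  · rw [map_add, map_add, hx, hy]

theorem indEMul_indEGen (r : D.BPE γ) : indEMul γ i (indEGen γ i r) =
    r * CrossedProduct.elt O (D.centH γ) (D.intHom γ) i 1 := rfl

/-- The coefficients of an endomorphism of the induced module. -/
def calECoeff : D.calE γ i →ₗ[O] MonoidAlgebra A (D.gFusion γ) where
  toFun f := bpeEmb γ (indEMul γ i (f.unop.1 (indEGen γ i 1)))
  map_add' f h := by simp
  map_smul' r f := by simp

/-- The induced module is generated by 1 ⊗ i, so a linear endomorphism is right multiplication by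
the image of this generator. -/
theorem calE_apply (hi : IsIdempotentElem i) (f : D.calE γ i) (n : D.indE γ i) :
    bpeEmb γ (indEMul γ i (f.unop.1 n)) = bpeEmb γ (indEMul γ i n) * calECoeff γ f := by
  have h : n = D.actE γ i (indEMul γ i n) (indEGen γ i 1) := by
    rw [actE_indEGen, mul_one, indEGen_indEMul γ hi]
  have hf := f.unop.2 _ ⟨indEMul γ i n, rfl⟩
  have hf' : f.unop.1 n = D.actE γ i (indEMul γ i n) (f.unop.1 (indEGen γ i 1)) := by
    conv_lhs => rw [h]
    exact (DFunLike.congr_fun hf _).symm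
  rw [hf', indEMul_actE, map_mul]
  rfl

theorem indEMul_injective (hi : IsIdempotentElem i) : Function.Injective (indEMul γ i) :=
  Function.LeftInverse.injective (indEGen_indEMul γ hi)

theorem indEGen_one_mem : indEGen γ i 1 ∈ D.indEComp γ i 1 := by
  refine Submodule.subset_span ⟨1, ?_, _, rfl⟩
  rw [← CrossedProduct.elt_one_one (O := O)]
  exact CrossedProduct.elt_mem_comp _ _ _ _

theorem bpeEmb_indEMul_of_mem {e : D.gFusion γ} {n : D.indE γ i} (hn : n ∈ D.indEComp γ i e) :
    ∃ a, bpeEmb γ (indEMul γ i n) = MonoidAlgebra.single e a := by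
  refine Submodule.span_induction ?_ ⟨0, by simp⟩ ?_ ?_ hn
  · rintro _ ⟨r, hr, m, rfl⟩
    obtain ⟨a, ha⟩ := bpeEmb_mem_comp γ hr
    refine ⟨a * ((m : D.fix P) * D.σ ((1 : D.normPt γ) : G)), ?_⟩
    rw [indEMul_tmul, map_mul, ha, bpeEmb_elt, MonoidAlgebra.single_mul_single, QuotientGroup.mk_one,
      mul_one]
  · rintro x y _ _ ⟨a, ha⟩ ⟨c, hc⟩
    exact ⟨a + c, by rw [map_add, map_add, ha, hc, MonoidAlgebra.single_add]⟩
  · rintro r x _ ⟨a, ha⟩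
    exact ⟨r • a, by rw [map_smul, map_smul, ha, MonoidAlgebra.smul_single]⟩

theorem unit_calECoeff :
    bpeEmb γ (indEMul γ i (indEGen γ i 1)) = MonoidAlgebra.single 1 (i : A) := by
  rw [indEMul_indEGen, one_mul, bpeEmb_elt]
  simp

theorem calECoeff_apply (f : D.calE γ i) :
    calECoeff γ f = bpeEmb γ (indEMul γ i (f.unop.1 (indEGen γ i 1))) := rfl

theorem single_one_mul_calECoeff (hi : IsIdempotentElem i) (f : D.calE γ i) :
    MonoidAlgebra.single 1 (i : A) * calECoeff γ f = calECoeff γ f := by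
  rw [← unit_calECoeff, ← calE_apply γ hi, calECoeff_apply]

theorem calECoeff_mul_single_one (hi : IsIdempotentElem i) (f : D.calE γ i) :
    calECoeff γ f * MonoidAlgebra.single 1 (i : A) = calECoeff γ f := by
  rw [← unit_calECoeff, calECoeff_apply, indEMul_indEGen, one_mul, ← map_mul, ← indEMul_indEGen,
    indEGen_indEMul γ hi]

theorem exists_calECoeff_of_mem {e : D.gFusion γ} {f : D.calE γ i} (hf : f ∈ D.calEComp γ i e) :
    ∃ a, calECoeff γ f = MonoidAlgebra.single e a := by
  have := hf 1 _ (indEGen_one_mem γ)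
  rw [one_mul] at this
  exact bpeEmb_indEMul_of_mem γ this

/-- For a representative g of e, write a = (ag⁻¹)g. The first factor has degree 1 and commutes with
P, so a at e comes from B^P * E, and right multiplication by it is the endomorphism. -/
theorem exists_calECoeff_eq {e : D.gFusion γ} {a : A}
    (ha : a ∈ D.fusionSpace i (gFusionHom γ e)) :
    ∃ f ∈ D.calEComp γ i e, calECoeff γ f = MonoidAlgebra.single e a := by
  obtain ⟨g, rfl⟩ := QuotientGroup.mk_surjective e
  obtain ⟨h1, h2, h3, h4⟩ := ha
  rw [gFusionHom_mk] at h3 h4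
  let s : D.fix P := ⟨a * D.σ (g : G)⁻¹, by
    have := D.grading.mul_mem h3 (D.σ_mem (g : G)⁻¹)
    rwa [QuotientGroup.mk_inv, mul_inv_cancel] at this, fun u hu => by
    have h := h4 ((normAut γ g)⁻¹ ⟨u, hu⟩)
    have hn := coe_normAut γ g ((normAut γ g)⁻¹ ⟨u, hu⟩)
    rw [MulAut.apply_inv_self] at h hn
    change u = _ at hn
    rw [← mul_assoc, h, mul_assoc, mul_assoc, ← map_mul, ← map_mul]
    conv_rhs => rw [hn]
    simp [mul_assoc]⟩
  let r : D.BPE γ := CrossedProduct.elt O (D.centH γ) (D.intHom γ) s g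
  have hr : bpeEmb γ r = MonoidAlgebra.single (g : D.gFusion γ) a := by
    rw [bpeEmb_elt]
    congr 1
    change a * D.σ (g : G)⁻¹ * D.σ (g : G) = a
    rw [mul_assoc, σ_inv_mul, mul_one]
  let f : Module.End O (D.indE γ i) :=
    indEGen γ i ∘ₗ LinearMap.mulRight O r ∘ₗ indEMul γ i
  have hf : f ∈ D.endE γ i := by
    rintro _ ⟨t, rfl⟩
    refine LinearMap.ext fun n => ?_
    change D.actE γ i t (indEGen γ i (indEMul γ i n * r)) =
      indEGen γ i (indEMul γ i (D.actE γ i t n) * r)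
    rw [actE_indEGen, indEMul_actE, mul_assoc]
  refine ⟨MulOpposite.op ⟨f, hf⟩, fun x n hn => ?_, ?_⟩
  · change indEGen γ i (indEMul γ i n * r) ∈ _
    refine Submodule.span_induction ?_ (by simp) (fun y z _ _ hy hz => ?_) (fun k y _ hy => ?_) hn
    · rintro _ ⟨t, ht, m, rfl⟩
      refine Submodule.subset_span ⟨_, ?_, _, rfl⟩
      rw [indEMul_tmul]
      refine CrossedProduct.mul_mem_comp _ _ ?_ (CrossedProduct.elt_mem_comp _ _ _ _)
      have := CrossedProduct.mul_mem_comp _ _ ht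
        (CrossedProduct.elt_mem_comp (O := O) (D.centH γ) (D.intHom γ) (m : D.fix P) 1)
      rwa [QuotientGroup.mk_one, mul_one] at this
    · rw [map_add, add_mul, map_add]; exact add_mem hy hz
    · rw [map_smul, smul_mul_assoc, map_smul]; exact Submodule.smul_mem _ _ hy
  · change bpeEmb γ (indEMul γ i (indEGen γ i (indEMul γ i (indEGen γ i 1) * r))) = _
    rw [indEMul_indEGen, indEMul_indEGen, one_mul, map_mul, map_mul, hr, bpeEmb_elt]
    simp [MonoidAlgebra.single_mul_single, h1, h2]

/-- In the opposite algebra the product fh applies f first, so the coefficients multiply in the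
order written. -/
theorem isCoeffModel_calE (hi : IsIdempotentElem i) :
    IsCoeffModel (R := D.calE γ i) (fun e => D.fusionSpace i (gFusionHom γ e)) (i : A)
      (calECoeff γ) where
  injective := by
    rw [injective_iff_map_eq_zero]
    intro f hf
    apply MulOpposite.unop_injective
    apply Subtype.ext
    refine LinearMap.ext fun n => ?_
    apply indEMul_injective γ hi
    apply bpeEmb_injective γ
    rw [calE_apply γ hi, hf, mul_zero]
    simp
  map_one := unit_calECoeff γ
  map_mul f h := calE_apply γ hi h (f.unop.1 (indEGen γ i 1))
  coeff_mem f e := by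
    obtain ⟨h3, h4⟩ := bpeEmb_coeff_mem γ (indEMul γ i (f.unop.1 (indEGen γ i 1))) e
    refine ⟨?_, ?_, h3, h4⟩
    · exact MonoidAlgebra.mul_coeff_of_single_one_mul (single_one_mul_calECoeff γ hi f) e
    · exact MonoidAlgebra.coeff_mul_of_mul_single_one (calECoeff_mul_single_one γ hi f) e
  exists_single e a ha := by
    obtain ⟨f, -, hf⟩ := exists_calECoeff_eq γ ha
    exact ⟨f, hf⟩

theorem mem_calEComp_iff (hi : IsIdempotentElem i) (e : D.gFusion γ) (f : D.calE γ i) :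
    f ∈ D.calEComp γ i e ↔ ∃ a, calECoeff γ f = MonoidAlgebra.single e a :=
  (isCoeffModel_calE γ hi).mem_iff (fun _ _ hf => exists_calECoeff_of_mem γ hf)
    (fun _ _ ha => exists_calECoeff_eq γ ha) e f

end GradedInterior

/-! ### The algebra of endomorphisms of the bimodule induced to the skew group algebra -/

namespace GradedInterior

variable {O : Type*} [CommRing O] {G : Type*} [Group G] {H : Subgroup G} [H.Normal]
  {A : Type*} [Ring A] [Algebra O A] {D : GradedInterior O H A} {P : Subgroup G} (i : D.fix P)

theorem σP_of (u : P) : D.σP P (MonoidAlgebra.of O P u) = D.σ u := by simp [σP]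

theorem smul_of (t : D.aFusion i) (u : P) :
    t • MonoidAlgebra.of O P u = MonoidAlgebra.of O P (t.1.1 u) := by
  change MonoidAlgebra.domCongr O O t.1.1 _ = _
  simp

theorem coe_rightP (s : MonoidAlgebra O P) (m : D.Ai i) :
    (D.rightP i s m : A) = (m : A) * D.σP P s := rfl

/-- The map `s t ↦ s t⁻¹` from `OP * F` to the group algebra of `F` over `A`. -/
def algCInv : D.algC i →ₗ[O] MonoidAlgebra A (D.aFusion i) :=
  MonoidAlgebra.mapDomainLinearMap O A (fun t => t⁻¹) ∘ₗ
    (MonoidAlgebra.coeffLinearEquiv O).symm.toLinearMap ∘ₗ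
    Finsupp.mapRange.linearMap (D.σP P).toLinearMap ∘ₗ
    (SkewMonoidAlgebra.coeffLinearEquiv (S := O)).toLinearMap

theorem algCInv_single (t : D.aFusion i) (s : MonoidAlgebra O P) :
    algCInv i (SkewMonoidAlgebra.single t s) = MonoidAlgebra.single t⁻¹ (D.σP P s) := by
  rw [← MonoidAlgebra.mapDomain_single (f := fun t : D.aFusion i => t⁻¹)]
  refine congrArg (MonoidAlgebra.mapDomain _) (congrArg MonoidAlgebra.ofCoeff ?_)
  exact Finsupp.mapRange_single (hf := map_zero (D.σP P))

theorem algCInv_leftP (s : MonoidAlgebra O P) (c : D.algC i) :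
    algCInv i (D.leftP i s c) = MonoidAlgebra.single 1 (D.σP P s) * algCInv i c := by
  induction c using SkewMonoidAlgebra.induction_on' with
  | single t w =>
    rw [leftP, LinearMap.mulLeft_apply, SkewMonoidAlgebra.single_mul_single, algCInv_single,
      algCInv_single, one_mul, one_smul,
      map_mul, MonoidAlgebra.single_mul_single, one_mul]
  | add c d hc hd => rw [map_add, map_add, map_add, hc, hd, mul_add]

/-- The map `m ⊗ s t ↦ m s t⁻¹` from `A i ⊗_{OP} C` to the group algebra of `F` over `A`. -/
def indFInv : D.indF i →ₗ[O] MonoidAlgebra A (D.aFusion i) :=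
  BalTensor.lift ((LinearMap.mul O (MonoidAlgebra A (D.aFusion i))).compl₁₂
    (MonoidAlgebra.lsingle 1 ∘ₗ (D.Ai i).subtype.restrictScalars O) (algCInv i)) (by
    intro s m c
    change MonoidAlgebra.single 1 ((m : A) * D.σP P s) * algCInv i c =
      MonoidAlgebra.single 1 (m : A) * algCInv i (D.leftP i s c)
    rw [algCInv_leftP, ← mul_assoc, MonoidAlgebra.single_mul_single, one_mul])

theorem indFInv_tmul (m : D.Ai i) (t : D.aFusion i) (s : MonoidAlgebra O P) :
    indFInv i (BalTensor.tmul _ _ m (SkewMonoidAlgebra.single t s)) =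
      MonoidAlgebra.single t⁻¹ ((m : A) * D.σP P s) := by
  change MonoidAlgebra.single 1 (m : A) * algCInv i (SkewMonoidAlgebra.single t s) = _
  rw [algCInv_single, MonoidAlgebra.single_mul_single, one_mul]

/-- The element `m ⊗ t`, as a linear map of `m`. -/
def indFSingle (t : D.aFusion i) : D.Ai i →ₗ[O] D.indF i :=
  (BalTensor.mk (D.rightP i) (D.leftP i)).flip (SkewMonoidAlgebra.single t 1)

theorem tmul_single (m : D.Ai i) (t : D.aFusion i) (s : MonoidAlgebra O P) :
    BalTensor.tmul _ _ m (SkewMonoidAlgebra.single t s) = indFSingle i t (D.rightP i s m) := by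
  change _ = BalTensor.tmul _ _ (D.rightP i s m) (SkewMonoidAlgebra.single t 1)
  rw [BalTensor.tmul_balanced]
  change _ = BalTensor.tmul _ _ m (SkewMonoidAlgebra.single 1 s * SkewMonoidAlgebra.single t 1)
  rw [SkewMonoidAlgebra.single_mul_single, one_mul, one_smul, mul_one]

theorem indFInv_indFSingle (t : D.aFusion i) (m : D.Ai i) :
    indFInv i (indFSingle i t m) = MonoidAlgebra.single t⁻¹ (m : A) := by
  have := indFInv_tmul i m t 1
  rwa [map_one, mul_one] at this

variable {i} in
@[elab_as_elim]
theorem indF_induction {p : D.indF i → Prop} (n : D.indF i) (single : ∀ t m, p (indFSingle i t m))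
    (add : ∀ x y, p x → p y → p (x + y)) : p n := by
  refine BalTensor.induction_on n (fun m c => ?_) add
  induction c using SkewMonoidAlgebra.induction_on' with
  | single t s => rw [tmul_single]; exact single _ _
  | add c d hc hd =>
    have : BalTensor.tmul (D.rightP i) (D.leftP i) m (c + d) =
        BalTensor.tmul _ _ m c + BalTensor.tmul _ _ m d :=
      map_add (BalTensor.mk (D.rightP i) (D.leftP i) m) c d
    rw [this]
    exact add _ _ hc hd

theorem exists_eq_sum_indFSingle (n : D.indF i) :
    ∃ c : D.aFusion i →₀ D.Ai i, n = c.sum fun t m => indFSingle i t m := by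
  refine indF_induction n (fun t m => ?_) ?_
  · refine ⟨Finsupp.single t m, ?_⟩
    rw [Finsupp.sum_single_index]
    exact map_zero _
  · rintro _ _ ⟨c, rfl⟩ ⟨d, rfl⟩
    refine ⟨c + d, ?_⟩
    rw [Finsupp.sum_add_index' (fun t => map_zero _) (fun t => map_add _)]

theorem indFInv_injective : Function.Injective (indFInv i) := by
  classical
  rw [injective_iff_map_eq_zero]
  intro n hn
  obtain ⟨c, rfl⟩ := exists_eq_sum_indFSingle i n
  have hc : ∀ t, c t = 0 := fun t => by
    have h := congrArg (fun z => z.coeff t⁻¹) hn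
    simp only [Finsupp.sum, map_sum, indFInv_indFSingle, MonoidAlgebra.coeff_sum,
      MonoidAlgebra.coeff_single, Finsupp.finsetSum_apply, Finsupp.single_apply, inv_inj,
      Finset.sum_ite_eq', MonoidAlgebra.coeff_zero, Finsupp.zero_apply] at h
    by_contra hne
    rw [if_pos (Finsupp.mem_support_iff.2 hne)] at h
    exact hne (Subtype.ext h)
  have : c = 0 := Finsupp.ext hc
  rw [this, Finsupp.sum_zero_index]

theorem actA_indFSingle (a : A) (t : D.aFusion i) (m : D.Ai i) :
    D.actA i a (indFSingle i t m) = indFSingle i t (a • m) := rfl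

theorem actC_indFSingle (t w : D.aFusion i) (s : MonoidAlgebra O P) (m : D.Ai i) :
    D.actC i (SkewMonoidAlgebra.single w s) (indFSingle i t m) =
      indFSingle i (t * w) (D.rightP i (t • s) m) := by
  rw [← tmul_single]
  change BalTensor.tmul _ _ m (SkewMonoidAlgebra.single t 1 * SkewMonoidAlgebra.single w s) = _
  rw [SkewMonoidAlgebra.single_mul_single, one_mul]

theorem actC_tmul (c d : D.algC i) (m : D.Ai i) :
    D.actC i c (BalTensor.tmul _ _ m d) = BalTensor.tmul _ _ m (d * c) := rfl

theorem indFInv_actA (a : A) (n : D.indF i) :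
    indFInv i (D.actA i a n) = MonoidAlgebra.single 1 a * indFInv i n := by
  refine indF_induction n (fun t m => ?_) fun x y hx hy => ?_
  · rw [actA_indFSingle, indFInv_indFSingle, indFInv_indFSingle, MonoidAlgebra.single_mul_single,
      one_mul]
    rfl
  · rw [map_add, map_add, map_add, hx, hy, mul_add]

/-- This is the purpose of the inverse in `indFInv`: the right action of F becomes left
multiplication, so that right C-linear endomorphisms can become right multiplications, with degrees
in the order of F. -/
theorem indFInv_actC_single (w : D.aFusion i) (n : D.indF i) :
    indFInv i (D.actC i (SkewMonoidAlgebra.single w 1) n) =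
      MonoidAlgebra.single w⁻¹ 1 * indFInv i n := by
  refine indF_induction n (fun t m => ?_) fun x y hx hy => ?_
  · rw [actC_indFSingle, indFInv_indFSingle, indFInv_indFSingle, MonoidAlgebra.single_mul_single,
      one_mul, mul_inv_rev, smul_one, coe_rightP, map_one, mul_one]
  · rw [map_add, map_add, map_add, hx, hy, mul_add]

/-- The coefficient at t belongs to the component of degree t⁻¹, and moving u to the left past t⁻¹
in C applies φ⁻¹, where φ is the automorphism in t. -/
theorem indFInv_actC_of_coeff (u : P) (n : D.indF i) (t : D.aFusion i) :
    (indFInv i (D.actC i (SkewMonoidAlgebra.single 1 (MonoidAlgebra.of O P u)) n)).coeff t =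
      (indFInv i n).coeff t * D.σ (t.1.1⁻¹ u : P) := by
  classical
  refine indF_induction n (fun w m => ?_) fun x y hx hy => ?_
  · rw [actC_indFSingle, indFInv_indFSingle, indFInv_indFSingle, coe_rightP, smul_of, σP_of,
      MonoidAlgebra.coeff_single, MonoidAlgebra.coeff_single, mul_one]
    by_cases h : w⁻¹ = t
    · subst h
      rw [Finsupp.single_eq_same, Finsupp.single_eq_same]
      simp
    · rw [Finsupp.single_eq_of_ne (Ne.symm h), Finsupp.single_eq_of_ne (Ne.symm h), zero_mul]
  · rw [map_add, map_add, map_add, MonoidAlgebra.coeff_add, MonoidAlgebra.coeff_add,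
      Finsupp.add_apply, Finsupp.add_apply, hx, hy, add_mul]

theorem indFInv_coeff_mem {x : G ⧸ H} {n : D.indF i} (hn : n ∈ D.indFGComp i x)
    (t : D.aFusion i) : (indFInv i n).coeff t ∈ D.comp (x * t.1.2) := by
  classical
  refine Submodule.span_induction ?_ (by simp) (fun a c _ _ ha hc => ?_) (fun k a _ ha => ?_) hn
  · rintro _ ⟨z, u, w, rfl, m, hm, rfl⟩
    rw [indFInv_tmul, σP_of, MonoidAlgebra.coeff_single]
    by_cases h : w⁻¹ = t
    · subst h
      have := D.grading.mul_mem (show (m : A) ∈ D.comp z from hm) (D.σ_mem u)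
      rw [Finsupp.single_eq_same]
      simpa using this
    · rw [Finsupp.single_eq_of_ne (Ne.symm h)]
      exact zero_mem _
  · rw [map_add, MonoidAlgebra.coeff_add, Finsupp.add_apply]
    exact add_mem ha hc
  · rw [map_smul, MonoidAlgebra.coeff_smul_apply]
    exact Submodule.smul_mem _ _ ha

theorem indFInv_of_mem_indFComp {t : D.aFusion i} {n : D.indF i} (hn : n ∈ D.indFComp i t) :
    ∃ a, indFInv i n = MonoidAlgebra.single t⁻¹ a := by
  refine Submodule.span_induction ?_ ⟨0, by simp⟩ ?_ ?_ hn
  · rintro _ ⟨m, s, rfl⟩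
    exact ⟨_, indFInv_tmul i m t s⟩
  · rintro x y _ _ ⟨a, ha⟩ ⟨c, hc⟩
    exact ⟨a + c, by rw [map_add, ha, hc, MonoidAlgebra.single_add]⟩
  · rintro r x _ ⟨a, ha⟩
    exact ⟨r • a, by rw [map_smul, ha, MonoidAlgebra.smul_single]⟩

/-- The generator `i ⊗ 1` of `A i ⊗_{OP} C`. -/
def indFGen : D.indF i := indFSingle i 1 ⟨i, Submodule.mem_span_singleton_self (i : A)⟩

theorem indFInv_indFGen : indFInv i (indFGen i) = MonoidAlgebra.single 1 (i : A) := by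
  rw [indFGen, indFInv_indFSingle, inv_one]

theorem indFGen_mem_indFComp : indFGen i ∈ D.indFComp i 1 :=
  Submodule.subset_span ⟨_, 1, rfl⟩

theorem indFGen_mem_indFGComp : indFGen i ∈ D.indFGComp i 1 :=
  Submodule.subset_span ⟨1, 1, 1, by simp, _, i.2.1, by rw [map_one]; rfl⟩

/-- The coefficients of an endomorphism of `A i ⊗_{OP} C`. -/
def calFCoeff : D.calF i →ₗ[O] MonoidAlgebra A (D.aFusion i) where
  toFun f := indFInv i (f.unop.1 (indFGen i))
  map_add' f h := by simp
  map_smul' r f := by simp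

theorem calFCoeff_apply (f : D.calF i) : calFCoeff i f = indFInv i (f.unop.1 (indFGen i)) := rfl

variable {i}

/-- The bimodule is generated by i ⊗ 1, as m ⊗ t = m(i ⊗ 1)t, and both outer actions of these
elements become left multiplications under `indFInv`. -/
theorem calF_apply (hi : IsIdempotentElem i) (f : D.calF i) (n : D.indF i) :
    indFInv i (f.unop.1 n) = indFInv i n * calFCoeff i f := by
  obtain ⟨h1, h2, -⟩ := f.unop.2
  refine indF_induction n (fun t m => ?_) fun x y hx hy => ?_
  · have hm : indFSingle i t m =
        D.actA i m (D.actC i (SkewMonoidAlgebra.single t 1) (indFGen i)) := by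
      rw [indFGen, actC_indFSingle, actA_indFSingle, one_mul, one_smul]
      congr 1
      refine Subtype.ext ?_
      change (m : A) = m * (i * D.σP P 1)
      rw [map_one, mul_one, (mem_Ai_iff hi).1 m.2]
    conv_lhs => rw [hm, h1, h2, indFInv_actA, indFInv_actC_single, ← calFCoeff_apply, ← mul_assoc,
      MonoidAlgebra.single_mul_single, one_mul, mul_one]
    rw [indFInv_indFSingle]
  · rw [map_add, map_add, map_add, hx, hy, add_mul]

theorem indFInv_mul_single_one (hi : IsIdempotentElem i) (n : D.indF i) :
    indFInv i n * MonoidAlgebra.single 1 (i : A) = indFInv i n := by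
  refine indF_induction n (fun t m => ?_) fun x y hx hy => ?_
  · rw [indFInv_indFSingle, MonoidAlgebra.single_mul_single, mul_one, (mem_Ai_iff hi).1 m.2]
  · rw [map_add, add_mul, hx, hy]

theorem actA_σ_indFGen (u : P) : D.actA i (D.σ u) (indFGen i) =
    D.actC i (SkewMonoidAlgebra.single 1 (MonoidAlgebra.of O P u)) (indFGen i) := by
  rw [indFGen, actA_indFSingle, actC_indFSingle, one_mul, one_smul]
  congr 1
  refine Subtype.ext ?_
  rw [coe_rightP_of]
  exact i.2.2 u u.2

/-- Apply f to the relation v(i ⊗ 1) = (i ⊗ 1)v for v = φ(u): on the coefficient at t the left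
action is by φ(u), while the right action is by φ⁻¹(φ(u)) = u. -/
theorem σ_mul_calFCoeff (f : D.calF i) (t : D.aFusion i) (u : P) :
    D.σ (t.1.1 u) * (calFCoeff i f).coeff t = (calFCoeff i f).coeff t * D.σ u := by
  obtain ⟨h1, h2, -⟩ := f.unop.2
  have h := congrArg f.unop.1 (actA_σ_indFGen (i := i) (t.1.1 u))
  rw [h1, h2] at h
  have := congrArg (fun n => (indFInv i n).coeff t) h
  simp only [indFInv_actA, indFInv_actC_of_coeff, MonoidAlgebra.coeff_single_one_mul,
    MulAut.inv_apply_self] at this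
  exact this

theorem exists_calFCoeff_of_mem {t : D.aFusion i} {f : D.calF i} (hf : f ∈ D.calFComp i t) :
    ∃ a, calFCoeff i f = MonoidAlgebra.single t a := by
  obtain ⟨a, ha⟩ := indFInv_of_mem_indFComp i (hf 1 _ (indFGen_mem_indFComp i))
  refine ⟨a, ?_⟩
  rw [mul_one, inv_inv] at ha
  exact ha

theorem σP_mul_of_mem_fusionSpace {t : D.aFusion i} {a : A} (ha : a ∈ D.fusionSpace i t.1)
    (s : MonoidAlgebra O P) : D.σP P s * a = a * D.σP P (t⁻¹ • s) := by
  induction s using MonoidAlgebra.induction_on with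
  | of u =>
    rw [smul_of, σP_of, σP_of]
    have := ha.2.2.2 (t.1.1⁻¹ u)
    rw [MulAut.apply_inv_self] at this
    exact this
  | add x y hx hy => rw [map_add, add_mul, smul_add, map_add, mul_add, hx, hy]
  | smul r x hx => rw [smul_comm, map_smul, map_smul, smul_mul_assoc, mul_smul_comm, hx]

/-- The endomorphism `m ⊗ c ↦ m a ⊗ t⁻¹ c` of `A i ⊗_{OP} C`. -/
def indFEnd {t : D.aFusion i} {a : A} (ha : a ∈ D.fusionSpace i t.1) : Module.End O (D.indF i) :=
  BalTensor.lift ((BalTensor.mk (D.rightP i) (D.leftP i)).compl₁₂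
    ((mulRightAi i a (mem_Ai_of_mem_fusionSpace ha)).restrictScalars O)
    (LinearMap.mulLeft O (SkewMonoidAlgebra.single t⁻¹ 1))) (by
    intro s m c
    change BalTensor.tmul (D.rightP i) (D.leftP i)
        (mulRightAi i a (mem_Ai_of_mem_fusionSpace ha) (D.rightP i s m))
        (SkewMonoidAlgebra.single t⁻¹ 1 * c) =
      BalTensor.tmul (D.rightP i) (D.leftP i) (mulRightAi i a (mem_Ai_of_mem_fusionSpace ha) m)
        (SkewMonoidAlgebra.single t⁻¹ 1 * (SkewMonoidAlgebra.single 1 s * c))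
    -- Why the map is balanced: sa = a(t⁻¹s) with t⁻¹ acting on s, and this same twist arises in C
    -- when s is moved across t⁻¹.
    have h1 : mulRightAi i a (mem_Ai_of_mem_fusionSpace ha) (D.rightP i s m) =
        D.rightP i (t⁻¹ • s) (mulRightAi i a (mem_Ai_of_mem_fusionSpace ha) m) := by
      refine Subtype.ext ?_
      change (m : A) * D.σP P s * a = m * a * D.σP P (t⁻¹ • s)
      rw [mul_assoc, σP_mul_of_mem_fusionSpace ha, mul_assoc]
    rw [h1, BalTensor.tmul_balanced, leftP, LinearMap.mulLeft_apply, ← mul_assoc, ← mul_assoc,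
      SkewMonoidAlgebra.single_mul_single, SkewMonoidAlgebra.single_mul_single]
    simp)

theorem indFEnd_tmul {t : D.aFusion i} {a : A} (ha : a ∈ D.fusionSpace i t.1)
    (m : D.Ai i) (c : D.algC i) : indFEnd ha (BalTensor.tmul _ _ m c) =
      BalTensor.tmul _ _ (mulRightAi i a (mem_Ai_of_mem_fusionSpace ha) m)
        (SkewMonoidAlgebra.single t⁻¹ 1 * c) := rfl

theorem indFEnd_indFSingle {t : D.aFusion i} {a : A} (ha : a ∈ D.fusionSpace i t.1)
    (w : D.aFusion i) (m : D.Ai i) : indFEnd ha (indFSingle i w m) =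
      indFSingle i (t⁻¹ * w) (mulRightAi i a (mem_Ai_of_mem_fusionSpace ha) m) := by
  change indFEnd ha (BalTensor.tmul _ _ m (SkewMonoidAlgebra.single w 1)) = _
  rw [indFEnd_tmul, SkewMonoidAlgebra.single_mul_single, smul_one, mul_one]
  rfl

theorem indFEnd_mem_endF {t : D.aFusion i} {a : A} (ha : a ∈ D.fusionSpace i t.1) :
    indFEnd ha ∈ D.endF i := by
  refine ⟨fun a' n => ?_, fun c n => ?_, fun x n hn => ?_⟩
  · refine indF_induction n (fun w m => ?_) fun x y hx hy => ?_
    · rw [actA_indFSingle, indFEnd_indFSingle, indFEnd_indFSingle, actA_indFSingle, map_smul]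
    · simp only [map_add, hx, hy]
  · refine BalTensor.induction_on n (fun m d => ?_) fun x y hx hy => ?_
    · rw [indFEnd_tmul, actC_tmul, actC_tmul, indFEnd_tmul, mul_assoc]
    · simp only [map_add, hx, hy]
  · refine Submodule.span_induction ?_ (by simp) (fun y z _ _ hy hz => ?_) (fun k y _ hy => ?_) hn
    · rintro _ ⟨z, u, w, rfl, m, hm, rfl⟩
      -- With y the second entry of t, ma has degree zy, and t⁻¹uw = φ⁻¹(u)t⁻¹w. The compatibility
      -- of φ with y-conjugation gives φ⁻¹(u) the class y⁻¹ūy, so the total degree is unchanged.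
      refine Submodule.subset_span ⟨z * t.1.2, (t⁻¹).1.1 u, t⁻¹ * w, ?_,
        mulRightAi i a (mem_Ai_of_mem_fusionSpace ha) m, D.grading.mul_mem hm ha.2.2.1, ?_⟩
      · rw [(t⁻¹).2.1 u]
        change z * t.1.2 * (t.1.2⁻¹ * _ * t.1.2⁻¹⁻¹) * (t.1.2⁻¹ * w.1.2) = _
        group
      · rw [indFEnd_tmul, SkewMonoidAlgebra.single_mul_single, one_mul, smul_of]
    · rw [map_add]; exact add_mem hy hz
    · rw [map_smul]; exact Submodule.smul_mem _ _ hy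

theorem exists_calFCoeff_eq {t : D.aFusion i} {a : A} (ha : a ∈ D.fusionSpace i t.1) :
    ∃ f ∈ D.calFComp i t, calFCoeff i f = MonoidAlgebra.single t a := by
  refine ⟨MulOpposite.op ⟨indFEnd ha, indFEnd_mem_endF ha⟩, fun x n hn => ?_, ?_⟩
  · change indFEnd ha n ∈ _
    refine Submodule.span_induction ?_ (by simp) (fun y z _ _ hy hz => ?_) (fun k y _ hy => ?_) hn
    · rintro _ ⟨m, s, rfl⟩
      rw [tmul_single, indFEnd_indFSingle]
      exact Submodule.subset_span ⟨_, 1, rfl⟩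
    · rw [map_add]; exact add_mem hy hz
    · rw [map_smul]; exact Submodule.smul_mem _ _ hy
  · rw [calFCoeff_apply]
    change indFInv i (indFEnd ha (indFGen i)) = _
    rw [indFGen, indFEnd_indFSingle, indFInv_indFSingle, mul_one, inv_inv]
    exact congrArg _ ha.1

/-- Each condition defining W_t has its own source: ia = a from linearity applied to the generator,
ai = a from values in Ai, the degree of a from preservation of the Ḡ-grading, and φ(u)a = au from
comparing the actions of A and C. -/
theorem isCoeffModel_calF (hi : IsIdempotentElem i) :
    IsCoeffModel (R := D.calF i) (fun t : D.aFusion i => D.fusionSpace i t.1) (i : A)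
      (calFCoeff i) where
  injective := by
    rw [injective_iff_map_eq_zero]
    intro f hf
    apply MulOpposite.unop_injective
    apply Subtype.ext
    refine LinearMap.ext fun n => ?_
    apply indFInv_injective i
    rw [calF_apply hi, hf, mul_zero]
    simp
  map_one := indFInv_indFGen i
  map_mul f h := calF_apply hi h (f.unop.1 (indFGen i))
  coeff_mem f t := by
    refine ⟨?_, ?_, ?_, fun u => ?_⟩
    · refine MonoidAlgebra.mul_coeff_of_single_one_mul ?_ t
      rw [← indFInv_indFGen, ← calF_apply hi, calFCoeff_apply]
    · exact MonoidAlgebra.coeff_mul_of_mul_single_one (indFInv_mul_single_one hi _) t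
    · have := indFInv_coeff_mem i (f.unop.2.2.2 1 _ (indFGen_mem_indFGComp i)) t
      rwa [one_mul] at this
    · exact σ_mul_calFCoeff f t u
  exists_single t a ha := by
    obtain ⟨f, -, hf⟩ := exists_calFCoeff_eq ha
    exact ⟨f, hf⟩

theorem mem_calFComp_iff (hi : IsIdempotentElem i) (t : D.aFusion i) (f : D.calF i) :
    f ∈ D.calFComp i t ↔ ∃ a, calFCoeff i f = MonoidAlgebra.single t a :=
  (isCoeffModel_calF hi).mem_iff (fun _ _ hf => exists_calFCoeff_of_mem hf)
    (fun _ _ ha => exists_calFCoeff_eq ha) t f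

end GradedInterior

end

/-! ### Conclusion: the two models are compared along the fusion isomorphism -/

theorem mainTheorem4 {p : ℕ} [Fact p.Prime]
    {O : Type*} [CommRing O] [IsDomain O] [IsDiscreteValuationRing O]
    [IsAdicComplete (IsLocalRing.maximalIdeal O) O] [CharP (IsLocalRing.ResidueField O) p]
    {G : Type*} [Group G] [Finite G] (H : Subgroup G) [H.Normal]
    (β : InvariantBlock O H)
    (P : Subgroup G) (hP : IsPGroup p P)
    (γ : Set (β.ext.fix P)) (hγ : β.ext.IsLocalPoint P γ)
    (i : β.ext.fix P) (hi : i ∈ γ) :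
    IsAlgGrading O (β.ext.calE γ i) (β.ext.calEComp γ i) ∧
    IsAlgGrading O (β.ext.calF i) (β.ext.calFComp i) ∧
    ∃ θ : β.ext.gFusion γ ≃* β.ext.aFusion i,
      (∀ g : β.ext.normPt γ,
        (∀ u : P, (((θ g).1.1 u : P) : G) = g * u * (g : G)⁻¹) ∧
        (θ g).1.2 = ((g : G) : G ⧸ H)) ∧
      ∃ Ψ : β.ext.calE γ i ≃ₐ[O] β.ext.calF i,
        ∀ e : β.ext.gFusion γ,
          (β.ext.calEComp γ i e).map Ψ.toLinearMap = β.ext.calFComp i (θ e) := by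
  have hidem : IsIdempotentElem i := by
    obtain ⟨⟨e, he, rfl⟩, -⟩ := hγ
    exact (he.of_isConj hi).idem
  have hE := GradedInterior.isCoeffModel_calE γ hidem
  have hF := GradedInterior.isCoeffModel_calF hidem
  have hE' := GradedInterior.mem_calEComp_iff γ hidem
  have hF' := GradedInterior.mem_calFComp_iff hidem
  refine ⟨hE.isAlgGrading hE', hF.isAlgGrading hF', β.fusionEquiv hγ hi, fun g => ?_, ?_⟩
  · rw [β.coe_fusionEquiv hγ hi, GradedInterior.gFusionHom_mk]
    exact ⟨fun u => rfl, rfl⟩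
  -- Both coefficient families are `fusionSpace` evaluated at a pair in Aut(P) × Ḡ, and θ preserves
  -- that pair.
  · exact hE.exists_algEquiv (β.fusionEquiv hγ hi)
      (fun e => by rw [β.coe_fusionEquiv hγ hi]) hF hE' hF'
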